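/- **Conventions.** A hypergraph $H=(V,E,i)$ consists of finite sets $V=V(H)$ and $E=E(H)$ and a map $i:E\to 2^V$ with $|i(e)|\ge 2$ for all $e\in E$ (so there are no loops, but parallel edges are allowed). The degree $d_H(v)$ is the number of edges $e$ with $v\in i(e)$; $\delta(H)$ and $\Delta(H)$ are the minimum and the maximum degree ($0$ if $V=\varnothing$), and a non-empty hypergraph is $r$-regular if all its vertices have degree $r$. A non-empty hypergraph is connected if any two of its vertices are joined by a hyperpath $(v_1,e_1,v_2,\dots,e_q,v_{q+1})$ with distinct vertices, distinct edges and $\{v_j,v_{j+1}\}\subseteq i(e_j)$ for all $j$. For $X\subseteq V(H)$, $H[X]$ is the induced subhypergraph with vertex set $X$ and edge set $\{e\in E: i(e)\subseteq X\}$, and $H-v=H[V(H)\setminus\{v\}]$. $K_n$ and $C_n$ are the complete graph and the cycle on $n$ vertices, and $tG$ arises from $G$ by replacing each edge by $t$ parallel edges. A hypergraph property is an isomorphism-closed class $\mathcal P$ of hypergraphs. It is non-trivial if it contains a non-empty hypergraph but not all hypergraphs, hereditary if it is closed under induced subhypergraphs, and additive if it is closed under vertex disjoint unions. Let $\mathcal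 F(\mathcal P)$ be the class of hypergraphs $H\notin\mathcal P$ with $H-v\in\mathcal P$ for all $v\in V(H)$, and let $d(\mathcal P)=\min\{\delta(H): H\in\mathcal F(\mathcal P)\}$. Let $\chi^\ell(H:\mathcal P)$ be the least integer $k\ge 0$ such that for every color set $C$ and every $L:V(H)\to 2^C$ with $|L(v)|\ge k$ for all $v$ there is a map $\varphi:V(H)\to C$ with $\varphi(v)\in L(v)$ for all $v\in V(H)$ and $H[\varphi^{-1}(c)]\in\mathcal P$ for all $c\in C$. **Theorem.** Let $\mathcal P$ be a non-trivial, hereditary and additive hypergraph property with $d(\mathcal P)=r$, and let $H$ be a connected hypergraph. Then $$\chi^\ell(H:\mathcal P)\le\left\lceil\frac{\Delta(H)}{r}\right\rceil+1,$$ and if equality holds, then at least one of the following is true (up to isomorphism): - $H=tK_{(kr+t)/t}$ for some integers $t\ge 1$ and $k\ge 0$ such that $(kr+t)/t$ is an integer; - $H=rC_n$ for some odd $n\ge 3$, and $\chi^\ell(H:\mathcal P)=3$; - $H$ is $r$-regular and $H\in\mathcal F(\mathcal P)$. -/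

import Mathlib

universe u v

/-- A finite hypergraph `(V, E, i)`: multiple (parallel) edges are allowed, and every edge is incident
to at least two vertices (so there are no loops). -/
structure MultiHypergraph : Type (u + 1) where
  /-- the vertices -/
  V : Type u
  /-- the edges -/
  E : Type u
  finV : Finite V
  finE : Finite E
  /-- the incidence function -/
  inc : E → Set V
  two_le_ncard : ∀ e, 2 ≤ (inc e).ncard

namespace MultiHypergraph

attribute [instance] MultiHypergraph.finV MultiHypergraph.finE

/-- Two hypergraphs are isomorphic: there are bijections between the vertices and between the edges
that respect the incidence functions. -/
def Isomorphic (H : MultiHypergraph.{u}) (H' : MultiHypergraph.{v}) : Prop :=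
  ∃ (f : H.V ≃ H'.V) (g : H.E ≃ H'.E), ∀ e, f '' H.inc e = H'.inc (g e)

/-- The subhypergraph `H[X]` induced by a set `X` of vertices: its edges are the edges of `H` all of
whose incident vertices belong to `X`. -/
def induce (H : MultiHypergraph.{u}) (X : Set H.V) : MultiHypergraph.{u} where
  V := X
  E := {e : H.E // H.inc e ⊆ X}
  finV := inferInstance
  finE := inferInstance
  inc e := Subtype.val ⁻¹' H.inc e.1
  two_le_ncard e := by
    have h : (Subtype.val ⁻¹' H.inc e.1 : Set X).ncard = (H.inc e.1).ncard := by
      rw [← Set.ncard_image_of_injective _ Subtype.val_injective,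
        Subtype.image_preimage_coe, Set.inter_eq_right.mpr e.2]
    rw [h]
    exact H.two_le_ncard e.1

/-- The vertex-deleted subhypergraph `H - v`. -/
def deleteVert (H : MultiHypergraph.{u}) (x : H.V) : MultiHypergraph.{u} :=
  H.induce {x}ᶜ

/-- The vertex disjoint union of two hypergraphs. -/
def disjUnion (H₁ H₂ : MultiHypergraph.{u}) : MultiHypergraph.{u} where
  V := H₁.V ⊕ H₂.V
  E := H₁.E ⊕ H₂.E
  finV := inferInstance
  finE := inferInstance
  inc e := Sum.elim (fun e₁ => Sum.inl '' H₁.inc e₁) (fun e₂ => Sum.inr '' H₂.inc e₂) e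
  two_le_ncard e := by
    rcases e with e | e
    · simpa [Set.ncard_image_of_injective _ Sum.inl_injective] using H₁.two_le_ncard e
    · simpa [Set.ncard_image_of_injective _ Sum.inr_injective] using H₂.two_le_ncard e

/-- The degree of a vertex: the number of edges incident to it. -/
noncomputable def degree (H : MultiHypergraph.{u}) (x : H.V) : ℕ :=
  {e : H.E | x ∈ H.inc e}.ncard

/-- The minimum degree `δ(H)`; it is `0` if `H` is empty. -/
noncomputable def minDegree (H : MultiHypergraph.{u}) : ℕ := ⨅ x, H.degree x

/-- The maximum degree `Δ(H)`; it is `0` if `H` is empty. -/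
noncomputable def maxDegree (H : MultiHypergraph.{u}) : ℕ := ⨆ x, H.degree x

/-- A non-empty hypergraph is `r`-regular if all its vertices have degree `r`. -/
def IsRegular (H : MultiHypergraph.{u}) (r : ℕ) : Prop :=
  Nonempty H.V ∧ ∀ x, H.degree x = r

/-- There is a hyperpath in `H` from `x` to `y`: a sequence `(p₀, e₀, p₁, …, e_{q-1}, p_q)` of
distinct vertices and distinct edges with `p₀ = x`, `p_q = y` and
`{p_j, p_{j+1}} ⊆ i(e_j)` for all `j < q`. -/
def HasHyperpath (H : MultiHypergraph.{u}) (x y : H.V) : Prop :=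
  ∃ (q : ℕ) (p : Fin (q + 1) → H.V) (e : Fin q → H.E),
    Function.Injective p ∧ Function.Injective e ∧ p 0 = x ∧ p (Fin.last q) = y ∧
      ∀ j : Fin q, p j.castSucc ∈ H.inc (e j) ∧ p j.succ ∈ H.inc (e j)

/-- A non-empty hypergraph is connected if any two of its vertices are joined by a hyperpath. -/
def IsConnected (H : MultiHypergraph.{u}) : Prop :=
  Nonempty H.V ∧ ∀ x y : H.V, H.HasHyperpath x y

/-- A simple graph, regarded as a hypergraph. -/
def ofSimpleGraph {W : Type u} [Finite W] (G : SimpleGraph W) : MultiHypergraph.{u} where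
  V := W
  E := G.edgeSet
  finV := inferInstance
  finE := inferInstance
  inc e := {x | x ∈ e.1}
  two_le_ncard e := by
    obtain ⟨e, he⟩ := e
    induction e using Sym2.ind with
    | _ a b =>
      have hab : a ≠ b := G.ne_of_adj he
      have hs : {x | x ∈ s(a, b)} = ({a, b} : Set W) := by ext x; simp
      change 2 ≤ ({x | x ∈ s(a, b)} : Set W).ncard
      rw [hs, Set.ncard_pair hab]

/-- The hypergraph `tH`: each edge of `H` is replaced by `t` parallel edges. -/
def multiply (t : ℕ) (H : MultiHypergraph.{u}) : MultiHypergraph.{u} where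
  V := H.V
  E := H.E × Fin t
  finV := inferInstance
  finE := inferInstance
  inc e := H.inc e.1
  two_le_ncard e := H.two_le_ncard e.1

/-- The complete graph `K_n`. -/
def K (n : ℕ) : MultiHypergraph.{0} := ofSimpleGraph (⊤ : SimpleGraph (Fin n))

/-- The cycle `C_n` (for `n ≥ 3`). -/
def C (n : ℕ) : MultiHypergraph.{0} := ofSimpleGraph (SimpleGraph.cycleGraph n)

/-! ### Hypergraph properties -/

/-- A hypergraph property is a class of hypergraphs that is closed under isomorphism. -/
def IsProperty (P : Set MultiHypergraph.{u}) : Prop :=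
  ∀ H H' : MultiHypergraph.{u}, H.Isomorphic H' → H ∈ P → H' ∈ P

/-- `P` contains a non-empty hypergraph, but not all hypergraphs. -/
def IsNontrivial (P : Set MultiHypergraph.{u}) : Prop :=
  (∃ H ∈ P, Nonempty H.V) ∧ ∃ H, H ∉ P

/-- `P` is closed under induced subhypergraphs. -/
def IsHereditary (P : Set MultiHypergraph.{u}) : Prop :=
  ∀ H ∈ P, ∀ X : Set H.V, H.induce X ∈ P

/-- `P` is closed under vertex disjoint unions. -/
def IsAdditive (P : Set MultiHypergraph.{u}) : Prop :=
  ∀ H₁ ∈ P, ∀ H₂ ∈ P, H₁.disjUnion H₂ ∈ P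

/-- The class `F(P)` of the hypergraphs `H` not in `P` such that `H - v` is in `P` for every
vertex `v` of `H`. -/
def minimalForbidden (P : Set MultiHypergraph.{u}) : Set MultiHypergraph.{u} :=
  {H | H ∉ P ∧ ∀ x : H.V, H.deleteVert x ∈ P}

/-- `d(P) = min {δ(H) | H ∈ F(P)}`; the class `F(P)` is non-empty whenever `P` is not the class of
all hypergraphs and is closed under isomorphism and under induced subhypergraphs. -/
noncomputable def dConst (P : Set MultiHypergraph.{u}) : ℕ :=
  sInf (minDegree '' minimalForbidden P)

/-! ### List colorings -/

/-- `H` is `(P, L)`-colorable: there is a coloring `φ` with `φ x ∈ L x` for every vertex `x` such that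
every color class induces a hypergraph belonging to `P`. -/
def ListColorable (P : Set MultiHypergraph.{u}) (H : MultiHypergraph.{u}) {S : Type u}
    (L : H.V → Set S) : Prop :=
  ∃ φ : H.V → S, (∀ x, φ x ∈ L x) ∧ ∀ c : S, H.induce (φ ⁻¹' {c}) ∈ P

/-- `H` is `(P, L)`-colorable for all color sets and all list-assignments `L` whose lists have at
least `k` elements. -/
def Choosable (P : Set MultiHypergraph.{u}) (H : MultiHypergraph.{u}) (k : ℕ) : Prop :=
  ∀ (S : Type u) (L : H.V → Set S), (∀ x, (k : ℕ∞) ≤ (L x).encard) → ListColorable P H L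

/-- The `P`-list-chromatic number of `H`: the least `k` such that `H` is `(P, L)`-colorable for all
list-assignments `L` with `|L x| ≥ k` for all `x` (and `⊤` if there were no such `k`). -/
noncomputable def listChromaticNumber (P : Set MultiHypergraph.{u}) (H : MultiHypergraph.{u}) : ℕ∞ :=
  ⨅ k ∈ {k : ℕ | Choosable P H k}, (k : ℕ∞)

end MultiHypergraph

namespace MultiHypergraph

/-! ### Double counting of edges by colour -/

section Counting

/-! Trim the lists to a common size `k`, and give each colour of a list the capacity `r = d(P)` and
every other colour the capacity `0`. A colour class outside `P` contains an induced member of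
`F(P)`, all of whose degrees are at least `r`. Hence a colouring whose classes are strictly
degenerate with respect to the capacities (`IsGood`) is a `(P, L)`-colouring. If the degrees do not
exceed the capacity sums `k * r` and there is no list colouring, the hypergraph is therefore bad
(`IsBad`, `exists_isBad`), and the task is to classify connected bad hypergraphs.

In a connected bad hypergraph, greedy colouring towards any vertex `z` leaves only `z` uncoloured,
and then every colour is exactly exhausted at `z` (`IsBad.colorDeg_eq`). So the degree equals the
capacity sum, which already gives the upper bound: with one more colour there is a surplus. The
tightness also lets the hole slide to an adjacent vertex and around a cycle, which rotates the
colours of the cycle (`IsBad.shift`, `IsBad.rotate`). If the hole sees only the first and the last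
of the other vertices of the cycle, comparing the colour counts at the hole before and after a
rotation shows that the colours alternate (`IsBad.cleanCycle_periodic`). On the other hand, two
vertices whose removal leaves a connected rest can be coloured first, with different colours
(`exists_good_of_pair`); at positions where the colours must agree this is a contradiction
(`IsBad.cleanCycle_false`).

Suppose that there is no cut-vertex and there are at least two usable colours. If no pair of
vertices separates, this contradiction yields a multiple of a complete graph. Otherwise a smallest
piece cut off by a pair is a single vertex with exactly two neighbours (`IsMinSep.subsingleton`);
this property spreads along edges (`IsNbrPair.unique_adj`), and the result is a multiple of an odd
cycle. Cut-vertices are excluded by a leaf-block argument (`IsBad.connOn_compl_singleton`): the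
block is bad for reduced capacities, hence regular, so it uses up all edges at its attachment
vertex.

For `k = 1` a minimal forbidden induced subhypergraph has all its degrees at least `r`, so no edge
leaves it and it is all of `H`; for `k = 0` there are no edges. -/

theorem ncard_setOf_eq_sum {α : Type*} [Fintype α] (p : α → Prop) [DecidablePred p] :
    {a | p a}.ncard = ∑ a, if p a then 1 else 0 := by
  rw [Set.ncard_eq_toFinset_card', Finset.sum_boole]
  simp

theorem sum_ncard_le {α κ : Type*} [Finite α] [Fintype κ] (p : κ → α → Prop) (q : α → Prop)
    (huniq : ∀ a c c', p c a → p c' a → c = c') (hpq : ∀ c a, p c a → q a) :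
    ∑ c, {a | p c a}.ncard ≤ {a | q a}.ncard := by
  classical
  have := Fintype.ofFinite α
  simp only [ncard_setOf_eq_sum]
  rw [Finset.sum_comm]
  refine Finset.sum_le_sum fun a _ => ?_
  rw [Finset.sum_boole]
  have h1 : (Finset.univ.filter fun c => p c a).card ≤ 1 :=
    Finset.card_le_one.2 fun c hc c' hc' =>
      huniq a c c' (Finset.mem_filter.1 hc).2 (Finset.mem_filter.1 hc').2
  split_ifs with h
  · exact_mod_cast h1
  · have : (Finset.univ.filter fun c => p c a) = ∅ :=
      Finset.filter_eq_empty_iff.2 fun c _ hc => h (hpq c a hc)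
    simp [this]

theorem sum_ncard_lt {α κ : Type*} [Finite α] [Fintype κ] (p : κ → α → Prop) (q : α → Prop)
    (huniq : ∀ a c c', p c a → p c' a → c = c') (hpq : ∀ c a, p c a → q a)
    (a₀ : α) (h₀ : q a₀) (h₁ : ∀ c, ¬ p c a₀) :
    ∑ c, {a | p c a}.ncard < {a | q a}.ncard := by
  refine (sum_ncard_le p (fun a => q a ∧ a ≠ a₀) huniq ?_).trans_lt ?_
  · rintro c a h
    exact ⟨hpq c a h, fun h' => h₁ c (h' ▸ h)⟩
  · refine Set.ncard_lt_ncard ⟨fun a h => h.1, fun h => ?_⟩ (Set.toFinite _)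
    exact (h (show q a₀ from h₀)).2 rfl

theorem sum_ncard_eq {α κ : Type*} [Finite α] [Fintype κ] (p : κ → α → Prop)
    (huniq : ∀ a c c', p c a → p c' a → c = c') :
    ∑ c, {a | p c a}.ncard = {a | ∃ c, p c a}.ncard := by
  classical
  have := Fintype.ofFinite α
  simp only [ncard_setOf_eq_sum]
  rw [Finset.sum_comm]
  refine Finset.sum_congr rfl fun a _ => ?_
  rw [Finset.sum_boole]
  split_ifs with h
  · obtain ⟨c, hc⟩ := h
    have : (Finset.univ.filter fun c => p c a) = {c} := by
      ext c'
      simp only [Finset.mem_filter, Finset.mem_univ, true_and, Finset.mem_singleton]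
      exact ⟨fun h => huniq a c' c h hc, fun h => h ▸ hc⟩
    simp [this]
  · push Not at h
    simp [h]

end Counting

/-! ### Colourings with capacities, and moving the uncoloured vertex -/

section Coloring

variable {κ : Type v} (H : MultiHypergraph.{u}) (f : H.V → κ → ℕ)

/-- Two distinct vertices are adjacent if some edge contains both. -/
def Adj (x y : H.V) : Prop := x ≠ y ∧ ∃ e, x ∈ H.inc e ∧ y ∈ H.inc e

/-- The degree of `x` in the subhypergraph induced by `Y`. -/
noncomputable def degIn (Y : Set H.V) (x : H.V) : ℕ := {e | x ∈ H.inc e ∧ H.inc e ⊆ Y}.ncard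

/-- On `A`, each colour class `c` of `φ` is strictly `f · c`-degenerate. -/
def IsGood (A : Set H.V) (φ : H.V → κ) : Prop :=
  ∀ Y ⊆ A, Y.Nonempty → ∀ c, (∀ y ∈ Y, φ y = c) → ∃ x ∈ Y, H.degIn Y x < f x c

/-- The number of edges at `x` all of whose other vertices lie in `A` and have colour `c`. -/
noncomputable def colorDeg (A : Set H.V) (φ : H.V → κ) (x : H.V) (c : κ) : ℕ :=
  {e | x ∈ H.inc e ∧ ∀ y ∈ H.inc e, y ≠ x → y ∈ A ∧ φ y = c}.ncard

/-- The number of edges containing `x` and `y`. -/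
noncomputable def mult (x y : H.V) : ℕ := {e | x ∈ H.inc e ∧ y ∈ H.inc e}.ncard

/-- `H` has enough colours for its degrees, but no good colouring. -/
def IsBad [Fintype κ] : Prop :=
  (∀ x, H.degree x ≤ ∑ c, f x c) ∧ ¬ ∃ φ, H.IsGood f Set.univ φ

variable {H f}

theorem Adj.symm {x y : H.V} (h : H.Adj x y) : H.Adj y x :=
  ⟨h.1.symm, h.2.imp fun _ he => ⟨he.2, he.1⟩⟩

theorem adj_of_mem {x y : H.V} {e : H.E} (hx : x ∈ H.inc e) (hy : y ∈ H.inc e) (h : x ≠ y) :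
    H.Adj x y := ⟨h, e, hx, hy⟩

theorem exists_mem_ne (e : H.E) (x : H.V) : ∃ y ∈ H.inc e, y ≠ x :=
  Set.exists_ne_of_one_lt_ncard (H.two_le_ncard e) x

theorem mult_pos {x y : H.V} (h : H.Adj x y) : 0 < H.mult x y := by
  obtain ⟨-, e, he⟩ := h
  exact (Set.ncard_pos (Set.toFinite _)).2 ⟨e, he⟩

theorem mult_comm (x y : H.V) : H.mult x y = H.mult y x := by
  unfold mult; congr 1; ext e; exact and_comm

theorem IsGood.mono {A A' : Set H.V} {φ : H.V → κ} (h : H.IsGood f A φ) (hA : A' ⊆ A) :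
    H.IsGood f A' φ := fun Y hY => h Y (hY.trans hA)

theorem IsGood.congr {A : Set H.V} {φ ψ : H.V → κ} (h : H.IsGood f A φ)
    (hA : ∀ x ∈ A, ψ x = φ x) : H.IsGood f A ψ := fun Y hY hne c hc =>
  h Y hY hne c fun y hy => (hA y (hY hy)).symm.trans (hc y hy)

theorem IsGood.pos {A : Set H.V} {φ : H.V → κ} (h : H.IsGood f A φ) {x : H.V} (hx : x ∈ A) :
    0 < f x (φ x) := by
  obtain ⟨y, rfl, hy⟩ := h {x} (by simpa using hx) ⟨x, rfl⟩ (φ x) (by rintro y rfl; rfl)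
  omega

theorem isGood_empty (φ : H.V → κ) : H.IsGood f ∅ φ := fun Y hY hne =>
  absurd hne (by rw [Set.subset_empty_iff.1 hY]; exact Set.not_nonempty_empty)

/-- In a monochromatic set containing `x`, the vertex `x` itself is the one of small degree: its
edges inside the set are among those counted by `colorDeg`. A set avoiding `x` lies in `A`. -/
theorem IsGood.insert_self {A : Set H.V} {φ : H.V → κ} (h : H.IsGood f A φ) {x : H.V}
    (hd : H.colorDeg A φ x (φ x) < f x (φ x)) : H.IsGood f (insert x A) φ := by
  intro Y hY hne c hc
  by_cases hx : x ∈ Y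
  · refine ⟨x, hx, ?_⟩
    obtain rfl := hc x hx
    refine lt_of_le_of_lt (Set.ncard_le_ncard ?_ (Set.toFinite _)) hd
    rintro e ⟨he, heY⟩
    exact ⟨he, fun y hy hyx => ⟨(hY (heY hy)).resolve_left hyx, hc y (heY hy)⟩⟩
  · refine h Y (fun y hy => (hY hy).resolve_left ?_) hne c hc
    rintro rfl
    exact hx hy

theorem colorDeg_congr {A : Set H.V} {φ ψ : H.V → κ} {x : H.V} {c : κ}
    (h : ∀ y ∈ A, y ≠ x → ψ y = φ y) : H.colorDeg A ψ x c = H.colorDeg A φ x c := by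
  unfold colorDeg
  congr 1
  ext e
  refine and_congr_right fun _ => forall_congr' fun y => forall_congr' fun _ =>
    forall_congr' fun hyx => and_congr_right fun hA => ?_
  rw [h y hA hyx]

theorem IsGood.insert_update [DecidableEq H.V] {A : Set H.V} {φ : H.V → κ} (h : H.IsGood f A φ)
    {x : H.V} (hx : x ∉ A) {c : κ} (hd : H.colorDeg A φ x c < f x c) :
    H.IsGood f (insert x A) (Function.update φ x c) := by
  have hne : ∀ y ∈ A, y ≠ x := by rintro y hy rfl; exact hx hy
  apply IsGood.insert_self
  · exact h.congr fun y hy => Function.update_of_ne (hne y hy) _ _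
  · rw [Function.update_self,
      colorDeg_congr (φ := φ) fun y hy hyx => Function.update_of_ne hyx _ _]
    exact hd

theorem colorDeg_uniq {A : Set H.V} {φ : H.V → κ} {x : H.V} (e : H.E) (c c' : κ)
    (h : x ∈ H.inc e ∧ ∀ y ∈ H.inc e, y ≠ x → y ∈ A ∧ φ y = c)
    (h' : x ∈ H.inc e ∧ ∀ y ∈ H.inc e, y ≠ x → y ∈ A ∧ φ y = c') : c = c' := by
  obtain ⟨y, hy, hyx⟩ := exists_mem_ne e x
  exact (h.2 y hy hyx).2.symm.trans (h'.2 y hy hyx).2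

theorem sum_colorDeg_le [Fintype κ] (A : Set H.V) (φ : H.V → κ) (x : H.V) :
    ∑ c, H.colorDeg A φ x c ≤ H.degree x :=
  sum_ncard_le _ _ colorDeg_uniq fun _ _ h => h.1

theorem sum_colorDeg_lt [Fintype κ] (A : Set H.V) (φ : H.V → κ) (x : H.V) (e : H.E)
    (he : x ∈ H.inc e) (h : ∀ c, ∃ y ∈ H.inc e, y ≠ x ∧ (y ∈ A → φ y ≠ c)) :
    ∑ c, H.colorDeg A φ x c < H.degree x := by
  refine sum_ncard_lt _ _ colorDeg_uniq (fun _ _ h => h.1) e he fun c hc => ?_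
  obtain ⟨y, hy, hyx, hn⟩ := h c
  exact hn (hc.2 y hy hyx).1 (hc.2 y hy hyx).2

/-- Greedy colouring: if `T` arises from `T₀` by successively adding adjacent vertices, then a good
colouring outside `T` extends to one outside `T₀`. -/
theorem exists_good_extend [Fintype κ] (hdeg : ∀ x, H.degree x ≤ ∑ c, f x c) {T₀ T : Set H.V}
    {φ : H.V → κ} (h : H.IsGood f Tᶜ φ) (hT : T₀ ⊆ T)
    (hgrow : ∀ T', T₀ ⊆ T' → T' ⊂ T → ∃ x ∈ T \ T', ∃ y ∈ T', H.Adj x y) :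
    ∃ φ', H.IsGood f T₀ᶜ φ' ∧ ∀ x ∉ T, φ' x = φ x := by
  classical
  -- The sets from whose complement every good colouring extends; a maximal one is shown to be all
  -- of `T`.
  let S : Set (Set H.V) := {T' | T₀ ⊆ T' ∧ T' ⊆ T ∧ ∀ φ : H.V → κ, H.IsGood f T'ᶜ φ →
    ∃ φ', H.IsGood f T₀ᶜ φ' ∧ ∀ x ∉ T', φ' x = φ x}
  have hS : T₀ ∈ S := ⟨subset_rfl, hT, fun φ hφ => ⟨φ, hφ, fun _ _ => rfl⟩⟩
  obtain ⟨M, hM⟩ := (Set.toFinite S).exists_maximal ⟨_, hS⟩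
  obtain ⟨⟨hM0, hMT, hMe⟩, hmax⟩ := hM
  rcases eq_or_ssubset_of_subset hMT with rfl | hlt
  · exact hMe φ h
  exfalso
  obtain ⟨x, ⟨hxT, hxM⟩, y, hy, hxy⟩ := hgrow M hM0 hlt
  refine hxM (hmax (y := insert x M) ⟨hM0.trans (Set.subset_insert _ _),
    Set.insert_subset hxT hMT, fun φ hφ => ?_⟩ (Set.subset_insert _ _) (Set.mem_insert _ _))
  obtain ⟨-, e, hxe, hye⟩ := hxy
  -- The edge joining `x` to the still uncoloured `y` counts for no colour, so some colour has room
  -- at `x`.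
  have hlt : ∑ c, H.colorDeg (insert x M)ᶜ φ x c < ∑ c, f x c :=
    (sum_colorDeg_lt _ _ _ e hxe fun c => ⟨y, hye, by rintro rfl; exact hxM hy,
      fun h => absurd (Set.mem_insert_of_mem x hy) h⟩).trans_le (hdeg x)
  obtain ⟨c, -, hc⟩ := Finset.exists_lt_of_sum_lt hlt
  have hg := hφ.insert_update (x := x) (fun h => h (Set.mem_insert _ _)) hc
  obtain ⟨φ', h1, h2⟩ := hMe (Function.update φ x c) (hg.mono (by
    intro z hz
    by_cases hzx : z = x
    · exact Or.inl hzx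
    · exact Or.inr fun h => h.elim hzx hz))
  refine ⟨φ', h1, fun z hz => ?_⟩
  rw [h2 z fun h => hz (Or.inr h), Function.update_of_ne]
  rintro rfl
  exact hz (Or.inl rfl)

section Bad

variable [Fintype κ] (hb : H.IsBad f)
include hb

/-- If colour `c` had room left at the hole, giving it to `z` would complete a good colouring. -/
theorem IsBad.le_colorDeg {z : H.V} {φ : H.V → κ} (h : H.IsGood f {z}ᶜ φ) (c : κ) :
    f z c ≤ H.colorDeg {z}ᶜ φ z c := by
  classical
  by_contra hlt
  refine hb.2 ⟨_, (h.insert_update (x := z) (by simp) (not_le.1 hlt)).mono ?_⟩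
  intro x _
  by_cases hx : x = z
  · exact Or.inl hx
  · exact Or.inr hx

theorem IsBad.degree_eq {z : H.V} {φ : H.V → κ} (h : H.IsGood f {z}ᶜ φ) :
    H.degree z = ∑ c, f z c :=
  (hb.1 z).antisymm ((Finset.sum_le_sum fun c _ => hb.le_colorDeg h c).trans
    (sum_colorDeg_le _ φ z))

/-- The chain `∑ f ≤ ∑ colorDeg ≤ degree ≤ ∑ f` collapses, so equality holds for each colour
separately. -/
theorem IsBad.colorDeg_eq {z : H.V} {φ : H.V → κ} (h : H.IsGood f {z}ᶜ φ) (c : κ) :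
    H.colorDeg {z}ᶜ φ z c = f z c := by
  have h1 : ∑ c, f z c = ∑ c, H.colorDeg {z}ᶜ φ z c :=
    (Finset.sum_le_sum fun c _ => hb.le_colorDeg h c).antisymm
      ((sum_colorDeg_le _ φ z).trans (hb.1 z))
  exact ((Finset.sum_eq_sum_iff_of_le fun c _ => hb.le_colorDeg h c).1 h1 c
    (Finset.mem_univ c)).symm

/-- An edge at the hole with two colours on its other vertices would count for no colour and break
the tight count. -/
theorem IsBad.mono_edge {z : H.V} {φ : H.V → κ} (h : H.IsGood f {z}ᶜ φ) {e : H.E}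
    (he : z ∈ H.inc e) {x y : H.V} (hx : x ∈ H.inc e) (hxz : x ≠ z) (hy : y ∈ H.inc e)
    (hyz : y ≠ z) : φ x = φ y := by
  by_contra hne
  have := sum_colorDeg_lt {z}ᶜ φ z e he fun c => by
    by_cases hc : φ x = c
    · exact ⟨y, hy, hyz, fun _ h => hne (hc.trans h.symm)⟩
    · exact ⟨x, hx, hxz, fun _ => hc⟩
  exact absurd (Finset.sum_le_sum fun c _ => hb.le_colorDeg h c)
    (not_le.2 (this.trans_le (hb.1 z)))

theorem IsBad.pos_of_adj {z x : H.V} {φ : H.V → κ} (h : H.IsGood f {z}ᶜ φ) (ha : H.Adj z x) :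
    0 < f z (φ x) := by
  rw [← hb.colorDeg_eq h]
  obtain ⟨hne, e, hz, hx⟩ := ha
  exact (Set.ncard_pos (Set.toFinite _)).2
    ⟨e, hz, fun y hy hyz => ⟨hyz, hb.mono_edge h hz hy hyz hx hne.symm⟩⟩

theorem IsBad.exists_adj_of_pos {z : H.V} {φ : H.V → κ} (h : H.IsGood f {z}ᶜ φ) {c : κ}
    (hc : 0 < f z c) : ∃ x, H.Adj z x ∧ φ x = c := by
  rw [← hb.colorDeg_eq h] at hc
  obtain ⟨e, hz, he⟩ := (Set.ncard_pos (Set.toFinite _)).1 hc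
  obtain ⟨y, hy, hyz⟩ := exists_mem_ne e z
  exact ⟨y, adj_of_mem hz hy hyz.symm, (he y hy hyz).2⟩

/-- The uncoloured vertex can be moved to any adjacent vertex. -/
theorem IsBad.shift [DecidableEq H.V] {z x : H.V} {φ : H.V → κ} (h : H.IsGood f {z}ᶜ φ)
    (ha : H.Adj z x) : H.IsGood f {x}ᶜ (Function.update φ z (φ x)) := by
  obtain ⟨hne, e, hz, hx⟩ := ha
  have h1 : H.IsGood f {z, x}ᶜ φ := h.mono (by intro y; simp; tauto)
  refine (h1.insert_update (x := z) (c := φ x) (by simp) ?_).mono ?_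
  · rw [← hb.colorDeg_eq h]
    -- With `x` uncoloured, the edge `e` drops out of a count that was exactly `f z (φ x)`, so this
    -- colour now fits at `z`.
    refine Set.ncard_lt_ncard ⟨?_, fun hs => ?_⟩ (Set.toFinite _)
    · rintro e' ⟨h1, h2⟩
      exact ⟨h1, fun y hy hyz => ⟨hyz, (h2 y hy hyz).2⟩⟩
    · have := hs (show e ∈ _ from
        ⟨hz, fun y hy hyz => ⟨hyz, hb.mono_edge h hz hy hyz hx hne.symm⟩⟩)
      exact (this.2 x hx hne.symm).1 (by simp)
  · intro y hy
    by_cases hyz : y = z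
    · exact Or.inl hyz
    · refine Or.inr ?_
      simp only [Set.mem_compl_iff, Set.mem_insert_iff, Set.mem_singleton_iff] at hy ⊢
      tauto

/-- Moving the uncoloured vertex once around a cycle rotates the colours of the cycle. -/
theorem IsBad.rotate {w : H.V} {φ : H.V → κ} (h : H.IsGood f {w}ᶜ φ) (p : ℕ → H.V) {m : ℕ}
    (hm : 1 ≤ m) (hp0 : p 0 = w) (hinj : ∀ i ≤ m, ∀ j ≤ m, p i = p j → i = j)
    (hadj : ∀ i < m, H.Adj (p i) (p (i + 1))) (hlast : H.Adj (p m) w) :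
    ∃ ψ, H.IsGood f {w}ᶜ ψ ∧ (∀ i, 1 ≤ i → i < m → ψ (p i) = φ (p (i + 1))) ∧
      ψ (p m) = φ (p 1) ∧ ∀ x, (∀ i ≤ m, x ≠ p i) → ψ x = φ x := by
  classical
  -- After `j` shifts the hole is at `p j`, and each vertex it has left carries the former colour of
  -- its successor.
  have key : ∀ j ≤ m, ∃ ψ, H.IsGood f {p j}ᶜ ψ ∧ (∀ i < j, ψ (p i) = φ (p (i + 1))) ∧
      ∀ x, (∀ i < j, x ≠ p i) → ψ x = φ x := by
    intro j
    induction j with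
    | zero => exact fun _ => ⟨φ, hp0 ▸ h, by simp, by simp⟩
    | succ j ih =>
      intro hj
      obtain ⟨ψ, h1, h2, h3⟩ := ih (by omega)
      refine ⟨_, hb.shift h1 (hadj j (by omega)), fun i hi => ?_, fun x hx => ?_⟩
      · by_cases hij : i = j
        · subst hij
          rw [Function.update_self, h3]
          intro i' hi' he
          have := hinj _ (by omega) _ (by omega) he
          omega
        · rw [Function.update_of_ne, h2 i (by omega)]
          intro he
          exact hij (hinj _ (by omega) _ (by omega) he)
      · rw [Function.update_of_ne (hx j (by omega)), h3 x fun i hi => hx i (by omega)]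
  obtain ⟨ψ, h1, h2, h3⟩ := key m le_rfl
  refine ⟨_, hb.shift h1 hlast, fun i hi him => ?_, ?_, fun x hx => ?_⟩
  · rw [Function.update_of_ne, h2 i him]
    intro he
    have := hinj _ (by omega) _ (by omega) he
    omega
  · rw [Function.update_self, ← hp0, h2 0 (by omega)]
  · rw [Function.update_of_ne (hx m le_rfl), h3 x fun i hi => hx i (by omega)]

end Bad

end Coloring

end MultiHypergraph

namespace MultiHypergraph

/-! ### Components, walks and paths -/

section Connectivity

variable (H : MultiHypergraph.{u})

/-- The vertices that can be reached from `r` by walks whose later vertices lie in `A`. -/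
def comp (A : Set H.V) (r : H.V) : Set H.V :=
  {x | Relation.ReflTransGen (fun a b => H.Adj a b ∧ b ∈ A) r x}

/-- Any two vertices of `A` are joined by a walk inside `A`. -/
def ConnOn (A : Set H.V) : Prop := ∀ r ∈ A, A ⊆ H.comp A r

variable {H} {A : Set H.V} {r x y : H.V}

theorem mem_comp_self : r ∈ H.comp A r := Relation.ReflTransGen.refl

theorem comp_subset (hr : r ∈ A) : H.comp A r ⊆ A := by
  intro x hx
  induction hx with
  | refl => exact hr
  | tail _ h _ => exact h.2

theorem mem_comp_of_adj (hx : x ∈ H.comp A r) (h : H.Adj x y) (hy : y ∈ A) : y ∈ H.comp A r :=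
  Relation.ReflTransGen.tail hx ⟨h, hy⟩

theorem comp_trans (hx : x ∈ H.comp A r) (hy : y ∈ H.comp A x) : y ∈ H.comp A r :=
  Relation.ReflTransGen.trans hx hy

theorem comp_symm (hr : r ∈ A) (hx : x ∈ H.comp A r) : r ∈ H.comp A x := by
  induction hx with
  | refl => exact mem_comp_self
  | @tail b c hb h ih =>
    exact comp_trans (mem_comp_of_adj mem_comp_self h.1.symm (comp_subset hr hb)) ih

/-- A walk that starts in `K` and ends outside has a step leaving `K`. Most connectivity arguments
below apply this to a well-chosen `K`. -/
theorem comp_boundary {K : Set H.V} (hr : r ∈ K) (hx : x ∈ H.comp A r) (hxK : x ∉ K) :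
    ∃ a ∈ K, ∃ b, b ∉ K ∧ H.Adj a b ∧ b ∈ A ∧ a ∈ H.comp A r ∧ b ∈ H.comp A r := by
  induction hx with
  | refl => exact absurd hr hxK
  | @tail b c hb h ih =>
    by_cases hbK : b ∈ K
    · exact ⟨b, hbK, c, hxK, h.1, h.2, hb, mem_comp_of_adj hb h.1 h.2⟩
    · exact ih hbK

theorem connOn_of_center (hc : ∀ x ∈ A, r ∈ H.comp A x) : H.ConnOn A := fun x hx y hy =>
  comp_trans (hc x hx) (comp_symm hy (hc y hy))

theorem connOn_of_center' (hr : r ∈ A) (hc : A ⊆ H.comp A r) : H.ConnOn A :=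
  connOn_of_center fun _ hx => comp_symm hr (hc hx)

theorem IsConnected.connOn_univ (h : H.IsConnected) : H.ConnOn Set.univ := by
  intro r _ x _
  obtain ⟨q, p, e, hp, -, rfl, rfl, he⟩ := h.2 r x
  have : ∀ j : Fin (q + 1), p j ∈ H.comp Set.univ (p 0) := by
    intro j
    induction j using Fin.induction with
    | zero => exact mem_comp_self
    | succ j ih =>
      refine mem_comp_of_adj ih (adj_of_mem (he j).1 (he j).2 fun h => ?_) trivial
      exact absurd (hp h) (Fin.castSucc_lt_succ).ne
  exact this _

theorem exists_path (ha : r ∈ A) (h : x ∈ H.comp A r) :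
    ∃ (n : ℕ) (q : ℕ → H.V), q 0 = r ∧ q n = x ∧ (∀ i ≤ n, q i ∈ A) ∧
      (∀ i ≤ n, ∀ j ≤ n, q i = q j → i = j) ∧ ∀ i < n, H.Adj (q i) (q (i + 1)) := by
  classical
  have hw : ∃ (n : ℕ) (q : ℕ → H.V), q 0 = r ∧ q n = x ∧ (∀ i ≤ n, q i ∈ A) ∧
      ∀ i < n, H.Adj (q i) (q (i + 1)) := by
    induction h with
    | refl => exact ⟨0, fun _ => r, rfl, rfl, fun _ _ => ha, by simp⟩
    | @tail b c hb h ih =>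
      obtain ⟨n, q, h0, hn, hA, hadj⟩ := ih
      refine ⟨n + 1, fun i => if i ≤ n then q i else c, by simp [h0], by simp, fun i hi => ?_,
        fun i hi => ?_⟩
      · simp only; split_ifs with hin
        · exact hA i hin
        · exact h.2
      · simp only; rw [if_pos (by omega)]; split_ifs with hin
        · exact hadj i (by omega)
        · obtain rfl : i = n := by omega
          rw [hn]; exact h.1
  obtain ⟨q, h0, hn, hA, hadj⟩ := Nat.find_spec hw
  refine ⟨_, q, h0, hn, hA, ?_, hadj⟩
  have key : ∀ i ≤ Nat.find hw, ∀ j ≤ Nat.find hw, i < j → q i ≠ q j := by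
    intro i hi j hj hij he
    -- A repetition `q i = q j` allows the segment between the two positions to be cut out, against
    -- the minimal length.
    refine Nat.find_min hw (m := Nat.find hw - (j - i)) (by omega)
      ⟨fun k => if k ≤ i then q k else q (k + (j - i)), by simp [h0], ?_, fun k hk => ?_,
        fun k hk => ?_⟩
    · simp only; split_ifs with hc
      · have : Nat.find hw - (j - i) = i := by omega
        rw [this, he, ← hn]
        congr 1; omega
      · refine Eq.trans ?_ hn
        congr 1; omega
    · simp only; split_ifs
      · exact hA _ (by omega)
      · exact hA _ (by omega)
    · simp only; split_ifs with h1 h2 h2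
      · exact hadj _ (by omega)
      · obtain rfl : k = i := by omega
        rw [he]
        have : k + 1 + (j - k) = j + 1 := by omega
        rw [this]
        exact hadj _ (by omega)
      · omega
      · have : k + 1 + (j - i) = k + (j - i) + 1 := by omega
        rw [this]
        exact hadj _ (by omega)
  intro i hi j hj he
  rcases lt_trichotomy i j with h | h | h
  · exact absurd he (key i hi j hj h)
  · exact h
  · exact absurd he.symm (key j hj i hi h)

end Connectivity

/-! ### Cycles through a given vertex -/

section Cycles

variable (H : MultiHypergraph.{u})

/-- `p 0 = w, p 1, …, p m` is a cycle through `w`. -/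
structure IsCycle (w : H.V) (p : ℕ → H.V) (m : ℕ) : Prop where
  two_le : 2 ≤ m
  zero : p 0 = w
  inj : ∀ i ≤ m, ∀ j ≤ m, p i = p j → i = j
  adj : ∀ i < m, H.Adj (p i) (p (i + 1))
  last : H.Adj (p m) w

/-- A cycle through `w` on which `w` has no neighbours but `p 1` and `p m`. -/
structure IsCleanCycle (w : H.V) (p : ℕ → H.V) (m : ℕ) : Prop extends H.IsCycle w p m where
  clean : ∀ i, 1 < i → i < m → ¬ H.Adj w (p i)

/-- All edges at `w` have exactly two vertices. -/
def GraphAt (w : H.V) : Prop :=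
  ∀ e, w ∈ H.inc e → ∀ x ∈ H.inc e, ∀ y ∈ H.inc e, x ≠ w → y ≠ w → x = y

variable {H}

theorem isCycle_triangle {w x y : H.V} (hx : H.Adj w x) (hxy : H.Adj x y) (hy : H.Adj y w) :
    H.IsCycle w (fun i => if i = 0 then w else if i = 1 then x else y) 2 where
  two_le := le_rfl
  zero := rfl
  inj := by
    have h1 := hx.1
    have h2 := hxy.1
    have h3 := hy.1
    intro i hi j hj
    interval_cases i <;> interval_cases j <;> simp [h1, h2, h3, h1.symm, h2.symm, h3.symm]
  adj := by
    intro i hi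
    interval_cases i <;> simpa
  last := by simpa

theorem exists_cycle_through {A : Set H.V} {w x y a b : H.V} (hw : w ∉ A) (hx : x ∉ A)
    (hy : y ∉ A) (hxy : x ≠ y) (hwx : H.Adj w x) (hwy : H.Adj w y) (ha : a ∈ A)
    (hb : b ∈ H.comp A a) (hxa : H.Adj x a) (hyb : H.Adj y b) :
    ∃ p m, H.IsCycle w p m ∧ 3 ≤ m ∧ p 1 = x ∧ p 2 = a ∧ p m = y ∧
      ∀ i, 1 < i → i < m → p i ∈ A := by
  obtain ⟨n, q, h0, hn, hA, hinj, hadj⟩ := exists_path ha hb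
  -- Position `0` is `w`, position `1` is `x`, positions `2` to `n + 2` carry the path from `a` to
  -- `b`, and position `n + 3` is `y`.
  let p : ℕ → H.V := fun i => if i = 0 then w else if i = 1 then x else if i ≤ n + 2 then q (i - 2)
    else y
  have hp0 : p 0 = w := rfl
  have hp1 : p 1 = x := rfl
  have hpq : ∀ i ≤ n, p (i + 2) = q i := fun i hi => by simp [p, hi]
  have hpm : p (n + 3) = y := by simp [p]
  have hcases : ∀ i ≤ n + 3, i = 0 ∨ i = 1 ∨ (∃ j ≤ n, i = j + 2) ∨ i = n + 3 := by
    intro i hi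
    by_cases h : 2 ≤ i ∧ i ≤ n + 2
    · exact Or.inr (Or.inr (Or.inl ⟨i - 2, by omega, by omega⟩))
    · omega
  refine ⟨p, n + 3, ⟨by omega, hp0, ?_, ?_, ?_⟩, by omega, hp1,
    (hpq 0 (by omega)).trans h0, hpm, ?_⟩
  · have hwq : ∀ i ≤ n, w ≠ q i := fun i hi h => hw (h ▸ hA i hi)
    have hxq : ∀ i ≤ n, x ≠ q i := fun i hi h => hx (h ▸ hA i hi)
    have hyq : ∀ i ≤ n, y ≠ q i := fun i hi h => hy (h ▸ hA i hi)
    have key : ∀ i ≤ n + 3, ∀ j ≤ n + 3, i < j → p i ≠ p j := by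
      intro i hi j hj hij
      rcases hcases i hi with rfl | rfl | ⟨i, hi', rfl⟩ | rfl <;>
        rcases hcases j hj with rfl | rfl | ⟨j, hj', rfl⟩ | rfl <;>
          first
          | omega
          | (rw [hpq _ hi', hpq _ hj']; intro h; have := hinj _ hi' _ hj' h; omega)
          | (rw [hpq _ hj']; first | exact hwq _ hj' | exact hxq _ hj')
          | (rw [hpq _ hi', hpm]; exact (hyq _ hi').symm)
          | (rw [hpm]; first | exact hwy.1 | exact hxy)
          | exact hwx.1
    intro i hi j hj he
    rcases lt_trichotomy i j with h | h | h
    · exact absurd he (key i hi j hj h)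
    · exact h
    · exact absurd he.symm (key j hj i hi h)
  · intro i hi
    rcases hcases i hi.le with rfl | rfl | ⟨i, hi', rfl⟩ | rfl
    · exact hwx
    · rw [hp1, show 1 + 1 = 0 + 2 from rfl, hpq 0 (by omega), h0]; exact hxa
    · rw [hpq i hi']
      rcases eq_or_lt_of_le hi' with rfl | hlt
      · rw [hn]; change H.Adj b (p (i + 3)); rw [hpm]; exact hyb.symm
      · have := hpq (i + 1) hlt
        rw [show i + 2 + 1 = i + 1 + 2 by omega, this]; exact hadj i hlt
    · omega
  · rw [hpm]; exact hwy.symm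
  · intro i h1 h2
    rcases hcases i h2.le with rfl | rfl | ⟨i, hi', rfl⟩ | rfl
    · omega
    · omega
    · rw [hpq i hi']; exact hA i hi'
    · omega

end Cycles

/-! ### Precolouring two vertices, and forced colours on clean cycles -/

section Coloring

variable {κ : Type v} {H : MultiHypergraph.{u}} {f : H.V → κ → ℕ}

theorem degIn_eq_zero {Y : Set H.V} {x : H.V} (h : Y ⊆ {x}) : H.degIn Y x = 0 := by
  rw [degIn, Set.ncard_eq_zero (Set.toFinite _), Set.eq_empty_iff_forall_notMem]
  rintro e ⟨-, he⟩
  obtain ⟨y, hy, hyx⟩ := exists_mem_ne e x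
  exact hyx (h (he hy))

theorem exists_good_compl_singleton [Fintype κ] (hdeg : ∀ x, H.degree x ≤ ∑ c, f x c)
    {T : Set H.V} {z : H.V} {φ : H.V → κ} (h : H.IsGood f Tᶜ φ) (hT : H.ConnOn T) (hz : z ∈ T) :
    ∃ φ', H.IsGood f {z}ᶜ φ' ∧ ∀ x ∉ T, φ' x = φ x := by
  refine exists_good_extend hdeg h (by simpa) fun T' h1 h2 => ?_
  obtain ⟨x, hx, hx'⟩ := Set.exists_of_ssubset h2
  obtain ⟨a, ha, b, hb, hab, hbT, -, -⟩ :=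
    comp_boundary (K := T') (h1 rfl) (hT z hz hx) hx'
  exact ⟨b, ⟨hbT, hb⟩, a, ha, hab.symm⟩

/-- Two vertices with different colours form singleton classes, which contain no edge, so positive
capacities suffice. The rest is connected and is coloured greedily towards `z`. -/
theorem exists_good_of_pair [Fintype κ] (hdeg : ∀ x, H.degree x ≤ ∑ c, f x c) {x y z : H.V}
    (hxy : x ≠ y) (hT : H.ConnOn {x, y}ᶜ) (hzx : z ≠ x) (hzy : z ≠ y) {a b : κ} (hab : a ≠ b)
    (ha : 0 < f x a) (hb : 0 < f y b) :
    ∃ φ, H.IsGood f {z}ᶜ φ ∧ φ x = a ∧ φ y = b := by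
  classical
  have hg : H.IsGood f ({x, y}ᶜ)ᶜ (fun t => if t = x then a else b) := by
    rw [compl_compl]
    intro Y hY hne c hc
    by_cases hx : x ∈ Y
    · refine ⟨x, hx, ?_⟩
      have hca : a = c := by simpa using hc x hx
      rw [degIn_eq_zero, ← hca]
      · exact ha
      · intro t ht
        rcases hY ht with rfl | rfl
        · rfl
        · have := hc t ht
          simp only [if_neg hxy.symm] at this
          exact absurd (hca.trans this.symm) hab
    · have hY' : Y ⊆ {y} := fun t ht => (hY ht).resolve_left (by rintro rfl; exact hx ht)
      obtain ⟨t, ht⟩ := hne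
      obtain rfl := hY' ht
      refine ⟨t, ht, ?_⟩
      have := hc t ht
      simp only [if_neg hxy.symm] at this
      rw [degIn_eq_zero hY', ← this]
      exact hb
  obtain ⟨φ, h1, h2⟩ := exists_good_compl_singleton hdeg hg hT (z := z) (by simp [hzx, hzy])
  refine ⟨φ, h1, ?_, ?_⟩
  · rw [h2 x (by simp)]; simp
  · rw [h2 y (by simp)]; simp [hxy.symm]

theorem exists_good_of_single [Fintype κ] (hdeg : ∀ x, H.degree x ≤ ∑ c, f x c) {x z : H.V}
    (hT : H.ConnOn {x}ᶜ) (hzx : z ≠ x) {a : κ} (ha : 0 < f x a) :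
    ∃ φ, H.IsGood f {z}ᶜ φ ∧ φ x = a := by
  have hg : H.IsGood f ({x}ᶜ)ᶜ (fun _ => a) := by
    rw [compl_compl]
    rintro Y hY ⟨t, ht⟩ c hc
    obtain rfl := hY ht
    exact ⟨t, ht, by rw [degIn_eq_zero hY, ← hc t ht]; exact ha⟩
  obtain ⟨φ, h1, h2⟩ := exists_good_compl_singleton hdeg hg hT (z := z) (by simp [hzx])
  exact ⟨φ, h1, h2 x (by simp)⟩

theorem colorDeg_eq_sum [Fintype H.V] [DecidableEq H.V] [DecidableEq κ] {w : H.V}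
    (hw : H.GraphAt w) (φ : H.V → κ) (c : κ) :
    H.colorDeg {w}ᶜ φ w c = ∑ x, if x ≠ w ∧ φ x = c then H.mult w x else 0 := by
  have h1 := sum_ncard_eq (fun (x : H.V) (e : H.E) =>
      (w ∈ H.inc e ∧ x ∈ H.inc e) ∧ (x ≠ w ∧ φ x = c))
    fun e x y hx hy => hw e hx.1.1 x hx.1.2 y hy.1.2 hx.2.1 hy.2.1
  have h2 : H.colorDeg {w}ᶜ φ w c = {e | ∃ x, (w ∈ H.inc e ∧ x ∈ H.inc e) ∧
      (x ≠ w ∧ φ x = c)}.ncard := by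
    unfold colorDeg
    congr 1
    ext e
    constructor
    · rintro ⟨he, h⟩
      obtain ⟨y, hy, hyw⟩ := exists_mem_ne e w
      exact ⟨y, ⟨he, hy⟩, hyw, (h y hy hyw).2⟩
    · rintro ⟨y, ⟨he, hy⟩, hyw, hc⟩
      refine ⟨he, fun t ht htw => ⟨htw, ?_⟩⟩
      rw [hw e he t ht y hy htw hyw, hc]
  rw [h2, ← h1]
  refine Finset.sum_congr rfl fun x _ => ?_
  split_ifs with h
  · simp [h, mult]
  · simp [h]

section Bad

variable [Fintype κ] (hb : H.IsBad f)
include hb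

theorem IsBad.rotate_triangle {w x y : H.V} {φ : H.V → κ} (h : H.IsGood f {w}ᶜ φ)
    (hx : H.Adj w x) (hxy : H.Adj x y) (hy : H.Adj y w) :
    ∃ ψ, H.IsGood f {w}ᶜ ψ ∧ ψ x = φ y ∧ ψ y = φ x ∧
      ∀ z, z ≠ w → z ≠ x → z ≠ y → ψ z = φ z := by
  have hc := isCycle_triangle hx hxy hy
  obtain ⟨ψ, h1, h2, h3, h4⟩ := hb.rotate h _ (by omega) hc.zero hc.inj hc.adj hc.last
  refine ⟨ψ, h1, by simpa using h2 1, by simpa using h3, fun z h5 h6 h7 => h4 z ?_⟩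
  intro i hi
  interval_cases i <;> simpa

/-- A pair of vertices that can be coloured first is not contained in an edge of size more
than two. -/
theorem IsBad.eq_or_eq_of_pair {x y : H.V} (hxy : x ≠ y) (hT : H.ConnOn {x, y}ᶜ) {a b : κ}
    (hab : a ≠ b) (ha : 0 < f x a) (hb' : 0 < f y b) {e : H.E} (hx : x ∈ H.inc e)
    (hy : y ∈ H.inc e) {z : H.V} (hz : z ∈ H.inc e) : z = x ∨ z = y := by
  by_contra! hne
  obtain ⟨φ, h1, h2, h3⟩ := exists_good_of_pair hb.1 hxy hT hne.1 hne.2 hab ha hb'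
  exact hab (by rw [← h2, ← h3]; exact hb.mono_edge h1 hz hx hne.1.symm hy hne.2.symm)

/-- The count of each colour at `w` equals its capacity both before and after a rotation, and only
the contributions of `p 1` and `p m` change. -/
theorem IsBad.cleanCycle_aux {w : H.V} (hw : H.GraphAt w) {φ : H.V → κ}
    (h : H.IsGood f {w}ᶜ φ) {p : ℕ → H.V} {m : ℕ} (hp : H.IsCleanCycle w p m) :
    φ (p 2) = φ (p m) ∧ (φ (p 1) ≠ φ (p m) → H.mult w (p 1) = H.mult w (p m)) := by
  classical
  have := Fintype.ofFinite H.V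
  have hm := hp.two_le
  obtain ⟨ψ, h1, h2, h3, h4⟩ := hb.rotate h p (by omega) hp.zero hp.inj hp.adj hp.last
  have hne : p m ≠ p 1 := fun h => by
    have := hp.inj _ le_rfl _ (by omega) h
    omega
  have hw1 : p 1 ≠ w := fun h => by
    have := hp.inj _ (by omega) 0 (by omega) (h.trans hp.zero.symm)
    omega
  have hwm : p m ≠ w := hp.last.1
  -- The left side is the contribution of `p 1` and `p m` before the rotation, the right side
  -- afterwards, when they carry the old colours of `p 2` and `p 1`.
  have key : ∀ c, (if φ (p 1) = c then H.mult w (p 1) else 0) +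
      (if φ (p m) = c then H.mult w (p m) else 0) =
      (if φ (p 2) = c then H.mult w (p 1) else 0) +
      (if φ (p 1) = c then H.mult w (p m) else 0) := by
    intro c
    have e1 := (hb.colorDeg_eq h c).trans (hb.colorDeg_eq h1 c).symm
    rw [colorDeg_eq_sum hw, colorDeg_eq_sum hw] at e1
    have hm1 : p m ∈ Finset.univ.erase (p 1) := by simp [hne]
    rw [← Finset.add_sum_erase _ _ (Finset.mem_univ (p 1)),
      ← Finset.add_sum_erase _ _ (Finset.mem_univ (p 1)), ← Finset.add_sum_erase _ _ hm1,
      ← Finset.add_sum_erase _ _ hm1] at e1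
    have e2 : ∀ x ∈ (Finset.univ.erase (p 1)).erase (p m),
        (if x ≠ w ∧ φ x = c then H.mult w x else 0) =
        (if x ≠ w ∧ ψ x = c then H.mult w x else 0) := by
      intro x hx
      simp only [Finset.mem_erase, Finset.mem_univ, and_true] at hx
      by_cases hxp : ∀ i ≤ m, x ≠ p i
      · rw [h4 x hxp]
      · push Not at hxp
        obtain ⟨i, hi, rfl⟩ := hxp
        by_cases hi0 : i = 0
        · subst hi0
          simp [hp.zero]
        · have hi1 : i ≠ 1 := by rintro rfl; exact hx.2 rfl
          have him : i ≠ m := by rintro rfl; exact hx.1 rfl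
          have : H.mult w (p i) = 0 := by
            by_contra h0
            obtain ⟨e, he⟩ := (Set.ncard_pos (Set.toFinite _)).1 (Nat.pos_of_ne_zero h0)
            refine hp.clean i (by omega) (by omega) (adj_of_mem he.1 he.2 ?_)
            rintro h
            have := hp.inj 0 (by omega) i hi (hp.zero.trans h)
            omega
          simp [this]
    rw [Finset.sum_congr rfl e2, ← add_assoc, ← add_assoc, add_left_inj] at e1
    have h2' : ψ (p 1) = φ (p 2) := h2 1 le_rfl (by omega)
    simpa [hw1, hwm, h2', h3] using e1
  have p1 : 0 < H.mult w (p 1) := mult_pos (by have := hp.adj 0 (by omega); rwa [hp.zero] at this)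
  have pm : 0 < H.mult w (p m) := mult_pos hp.last.symm
  have hd : φ (p 2) = φ (p m) := by
    by_contra hd
    -- For this colour the two sides would differ by a positive multiplicity.
    have := key (φ (p m))
    rw [if_pos rfl, if_neg hd] at this
    split_ifs at this <;> omega
  refine ⟨hd, fun hab => ?_⟩
  have := key (φ (p 1))
  rw [if_pos rfl, if_neg hab.symm, hd, if_neg hab.symm, if_pos rfl] at this
  omega

/-- Applying `cleanCycle_aux` after each number of rotations gives the cyclic colour sequence of `p
1, …, p m` the period `2`; it has the period `m` anyway, so it is constant when `m` is odd. -/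
theorem IsBad.cleanCycle_periodic {w : H.V} (hw : H.GraphAt w) {φ : H.V → κ}
    (h : H.IsGood f {w}ᶜ φ) {p : ℕ → H.V} {m : ℕ} (hp : H.IsCleanCycle w p m) {i j : ℕ}
    (hi : 1 ≤ i) (him : i ≤ m) (hj : 1 ≤ j) (hjm : j ≤ m) (hij : i % 2 = j % 2 ∨ m % 2 = 1) :
    φ (p i) = φ (p j) := by
  have hm := hp.two_le
  -- The colours of `p 1, …, p m`, repeated with period `m`; after `k` rotations `p (1 + i)` has the
  -- colour `c (i + k)`.
  let c : ℕ → κ := fun k => φ (p (1 + k % m))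
  have hcm : ∀ k, c (k + m) = c k := fun k => by simp [c]
  have hrot : ∀ k, ∃ ψ, H.IsGood f {w}ᶜ ψ ∧ ∀ i < m, ψ (p (1 + i)) = c (i + k) := by
    intro k
    induction k with
    | zero => exact ⟨φ, h, fun i hi => by simp [c, Nat.mod_eq_of_lt hi]⟩
    | succ k ih =>
      obtain ⟨ψ, h1, h2⟩ := ih
      obtain ⟨ψ', h1', h2', h3', -⟩ := hb.rotate h1 p (by omega) hp.zero hp.inj hp.adj hp.last
      refine ⟨ψ', h1', fun i hi => ?_⟩
      by_cases him : 1 + i < m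
      · rw [h2' _ (by omega) him, show 1 + i + 1 = 1 + (i + 1) by omega, h2 _ (by omega)]
        congr 1; omega
      · have : 1 + i = m := by omega
        rw [this, h3', show 1 = 1 + 0 from rfl, h2 0 (by omega),
          show i + (k + 1 + 0) = 0 + k + m by omega, hcm]
  have h1 : ∀ k, c (k + 1) = c (k + m - 1) := by
    intro k
    obtain ⟨ψ, h1, h2⟩ := hrot k
    have := (hb.cleanCycle_aux hw h1 hp).1
    rw [show 2 = 1 + 1 from rfl, h2 1 (by omega)] at this
    have h3 := h2 (m - 1) (by omega)
    rw [show 1 + (m - 1) = m by omega] at h3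
    rw [h3] at this
    rw [add_comm k 1, this]; congr 1; omega
  -- Modulo `m`, `h1` compares the two neighbours of position `k`; re-indexing by multiples of `m`
  -- avoids subtraction below zero.
  have h2 : ∀ k, c (k + 2) = c k := by
    have h3 : ∀ k, c (k + 1 + 2) = c (k + 1) := fun k => by
      have := h1 (k + 2)
      rw [show k + 2 + m - 1 = k + 1 + m by omega, hcm] at this
      exact this
    intro k
    have := h3 (k + m - 1)
    rw [show k + m - 1 + 1 + 2 = k + 2 + m by omega, show k + m - 1 + 1 = k + m by omega, hcm,
      hcm] at this
    exact this
  have h3 : ∀ n k, c (k + 2 * n) = c k := by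
    intro n
    induction n with
    | zero => intro k; rfl
    | succ n ih => intro k; rw [show k + 2 * (n + 1) = k + 2 * n + 2 by ring, h2, ih]
  have h4 : ∀ k l, k % 2 = l % 2 → c k = c l := by
    intro k l hkl
    rw [← Nat.mod_add_div k 2, ← Nat.mod_add_div l 2, h3, h3, hkl]
  have hc : ∀ i, 1 ≤ i → i ≤ m → φ (p i) = c (i - 1) := fun i h1 h2 => by
    simp only [c]
    rw [Nat.mod_eq_of_lt (by omega)]; congr 2; omega
  rw [hc i hi him, hc j hj hjm]
  by_cases h5 : i % 2 = j % 2
  · exact h4 _ _ (by omega)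
  -- Here `m` is odd, so adding the period `m` changes the parity.
  · rw [← hcm (i - 1)]
    exact h4 _ _ (by omega)

theorem IsBad.cleanCycle_false {w : H.V} (hw : H.GraphAt w) {p : ℕ → H.V} {m : ℕ}
    (hp : H.IsCleanCycle w p m) {i j : ℕ} (hi : 1 ≤ i) (him : i ≤ m) (hj : 1 ≤ j) (hjm : j ≤ m)
    (hne : i ≠ j) (hij : i % 2 = j % 2 ∨ m % 2 = 1) (hT : H.ConnOn {p i, p j}ᶜ) {a b : κ}
    (hab : a ≠ b) (ha : 0 < f (p i) a) (hb' : 0 < f (p j) b) : False := by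
  have hw' : ∀ i, 1 ≤ i → i ≤ m → w ≠ p i := fun i h1 h2 h3 => by
    have := hp.inj 0 (by omega) i h2 (hp.zero.trans h3)
    omega
  obtain ⟨φ, h1, h2, h3⟩ := exists_good_of_pair hb.1
    (fun h => hne (hp.inj _ him _ hjm h)) hT (hw' i hi him) (hw' j hj hjm) hab ha hb'
  exact hab (by rw [← h2, ← h3]; exact hb.cleanCycle_periodic hw h1 hp hi him hj hjm hij)

end Bad

end Coloring

end MultiHypergraph

namespace MultiHypergraph

/-! ### Constructing clean cycles through non-neighbours -/

section CleanCycles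

variable {H : MultiHypergraph.{u}}

/-- The vertices different from `w` and not adjacent to `w`. -/
def nonNbrs (H : MultiHypergraph.{u}) (w : H.V) : Set H.V := {x | x ≠ w ∧ ¬ H.Adj w x}

/-- A walk from `s` to `w` must leave the component of `s` among the non-neighbours of `w`; the
vertex it steps onto is not in that component, hence is a neighbour of `w`. -/
theorem exists_attached {w s : H.V} (hs : s ∈ H.nonNbrs w) {B : Set H.V} (hB : w ∈ H.comp B s) :
    ∃ x ∈ B, H.Adj w x ∧ ∃ a ∈ H.comp (H.nonNbrs w) s, H.Adj x a := by
  obtain ⟨a, ha, b, hb, hab, hbB, -, -⟩ :=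
    comp_boundary (K := H.comp (H.nonNbrs w) s) mem_comp_self hB
      (fun h => (comp_subset hs h).1 rfl)
  refine ⟨b, hbB, ?_, a, ha, hab.symm⟩
  by_contra hwb
  have hbw : b ≠ w := by
    rintro rfl
    exact (comp_subset hs ha).2 hab.symm
  exact hb (mem_comp_of_adj ha hab ⟨hbw, hwb⟩)

theorem exists_attached_pair (h2 : ∀ x, H.ConnOn {x}ᶜ) {w s : H.V} (hs : s ∈ H.nonNbrs w)
    {x : H.V} (hwx : H.Adj w x) :
    ∃ y ≠ x, H.Adj w y ∧ ∃ a ∈ H.comp (H.nonNbrs w) s, H.Adj y a :=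
  exists_attached hs (h2 x s (by rintro rfl; exact hs.2 hwx) hwx.1)

theorem comp_subset_comp_comp {A : Set H.V} {a s : H.V} (ha : a ∈ H.comp A s) :
    H.comp A a ⊆ H.comp (H.comp A s) a := by
  intro b hb
  induction hb with
  | refl => exact mem_comp_self
  | tail hb h ih => exact mem_comp_of_adj ih h.1 (mem_comp_of_adj (comp_trans ha hb) h.1 h.2)

/-- Joining two attached neighbours by a path through the component gives a cycle whose inner
vertices are non-neighbours of `w`, which is cleanness. -/
theorem exists_cleanCycle {w s x y : H.V} (hs : s ∈ H.nonNbrs w) (hxy : x ≠ y)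
    (hx : H.Adj w x ∧ ∃ a ∈ H.comp (H.nonNbrs w) s, H.Adj x a)
    (hy : H.Adj w y ∧ ∃ a ∈ H.comp (H.nonNbrs w) s, H.Adj y a) :
    ∃ p m, H.IsCleanCycle w p m ∧ 3 ≤ m ∧ p 1 = x ∧ p m = y ∧
      ∀ i, 1 < i → i < m → p i ∈ H.comp (H.nonNbrs w) s := by
  have hsub := comp_subset hs
  obtain ⟨hwx, a, ha, hxa⟩ := hx
  obtain ⟨hwy, b, hb, hyb⟩ := hy
  obtain ⟨p, m, h1, h2, h3, -, h4, h5⟩ := exists_cycle_through (A := H.comp (H.nonNbrs w) s)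
    (fun h => (hsub h).1 rfl) (fun h => (hsub h).2 hwx) (fun h => (hsub h).2 hwy) hxy hwx hwy ha
    (comp_subset_comp_comp ha (comp_trans (comp_symm hs ha) hb)) hxa hyb
  exact ⟨p, m, ⟨h1, fun i hi him => (hsub (h5 i hi him)).2⟩, h2, h3, h4, h5⟩

theorem isCleanCycle_triangle {w x y : H.V} (hx : H.Adj w x) (hxy : H.Adj x y) (hy : H.Adj y w) :
    H.IsCleanCycle w (fun i => if i = 0 then w else if i = 1 then x else y) 2 :=
  ⟨isCycle_triangle hx hxy hy, by intro i h1 h2; omega⟩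

end CleanCycles

/-! ### No separating pair: multiples of complete graphs -/

section Structure

variable {κ : Type v} {H : MultiHypergraph.{u}} {f : H.V → κ → ℕ} [Fintype κ] (hb : H.IsBad f)
include hb

theorem IsBad.exists_hole [Nonempty κ] (h1 : H.ConnOn Set.univ) (z : H.V) :
    ∃ φ, H.IsGood f {z}ᶜ φ := by
  obtain ⟨c⟩ := ‹Nonempty κ›
  obtain ⟨φ, hφ, -⟩ := exists_good_compl_singleton hb.1 (φ := fun _ => c)
    (by rw [Set.compl_univ]; exact isGood_empty _) h1 (Set.mem_univ z)
  exact ⟨φ, hφ⟩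

/-- Along an edge: colour one end first with `c` and leave the hole at the other end, where `c` then
occurs and so has positive capacity. Thus all vertices have the same usable colours. -/
theorem IsBad.pos_iff_pos (h1 : H.ConnOn Set.univ) (h2 : ∀ x, H.ConnOn {x}ᶜ) {x y : H.V} {c : κ}
    (hc : 0 < f x c) : 0 < f y c := by
  have hy : y ∈ H.comp Set.univ x := h1 x trivial trivial
  induction hy with
  | refl => exact hc
  | @tail y z _ h ih =>
    obtain ⟨φ, h3, rfl⟩ := exists_good_of_single hb.1 (h2 y) h.1.1.symm ih
    exact hb.pos_of_adj h3 h.1.symm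

theorem IsBad.mult_eq_of_triangle {w x y : H.V} (hw : H.GraphAt w) (hx : H.Adj w x)
    (hxy : H.Adj x y) (hy : H.Adj y w) (hT : H.ConnOn {x, y}ᶜ) {a b : κ} (hab : a ≠ b)
    (ha : 0 < f x a) (hb' : 0 < f y b) : H.mult w x = H.mult w y := by
  obtain ⟨φ, h1, rfl, rfl⟩ := exists_good_of_pair hb.1 hxy.1 hT hx.1 hy.1.symm hab ha hb'
  exact (hb.cleanCycle_aux hw h1 (isCleanCycle_triangle hx hxy hy)).2 hab

/-- If any two vertices can be coloured first, then `H` is a multiple of a complete graph. -/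
theorem IsBad.complete_of_pairs (h1 : H.ConnOn Set.univ) (h2 : ∀ x, H.ConnOn {x}ᶜ)
    (hp : ∀ x y, x ≠ y → H.ConnOn {x, y}ᶜ) {a b : κ} (hab : a ≠ b) (ha : ∀ x, 0 < f x a)
    (hb' : ∀ x, 0 < f x b) :
    (∀ w, H.GraphAt w) ∧ (∀ x y, x ≠ y → H.Adj x y) ∧
      ∃ t, 1 ≤ t ∧ ∀ x y, x ≠ y → H.mult x y = t := by
  have hg : ∀ w, H.GraphAt w := by
    intro w e hw x hx y hy hxw hyw
    exact ((hb.eq_or_eq_of_pair hxw.symm (hp w x hxw.symm) hab (ha w) (hb' x) hw hx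
      hy).resolve_left hyw).symm
  have hadj : ∀ x y, x ≠ y → H.Adj x y := by
    intro w s hws
    by_contra hadj
    have hs : s ∈ H.nonNbrs w := ⟨hws.symm, hadj⟩
    obtain ⟨x, -, hx⟩ := exists_attached hs (B := Set.univ) (h1 s trivial trivial)
    obtain ⟨y, hyx, hy⟩ := exists_attached_pair h2 hs hx.1
    obtain ⟨p, m, h3, h4, -, -, -⟩ := exists_cleanCycle hs hyx.symm hx hy
    -- Positions `1` and `3` have equal parity and exist because `m ≥ 3`.
    refine hb.cleanCycle_false (hg w) h3 (i := 1) (j := 3) le_rfl (by omega) (by omega) h4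
      (by omega) (by omega) (hp _ _ fun h => ?_) hab (ha _) (hb' _)
    have := h3.inj _ (by omega) _ h4 h
    omega
  refine ⟨hg, hadj, ?_⟩
  by_cases hV : ∃ p q : H.V, p ≠ q
  · obtain ⟨p, q, hpq⟩ := hV
    have htri : ∀ x y z, x ≠ y → x ≠ z → H.mult x y = H.mult x z := by
      intro x y z hxy hxz
      by_cases hyz : y = z
      · rw [hyz]
      · exact hb.mult_eq_of_triangle (hg x) (hadj x y hxy) (hadj y z hyz) (hadj z x hxz.symm)
          (hp y z hyz) hab (ha y) (hb' z)
    refine ⟨H.mult p q, mult_pos (hadj p q hpq), fun x y hxy => ?_⟩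
    by_cases hxp : x = p
    · subst hxp; exact htri x y q hxy hpq
    · rw [htri x y p hxy hxp, mult_comm, htri p x q (Ne.symm hxp) hpq]
  · push Not at hV
    exact ⟨1, le_rfl, fun x y hxy => absurd (hV x y) hxy⟩

end Structure

end MultiHypergraph

namespace MultiHypergraph

/-! ### Smallest pieces cut off by two vertices -/

section Separations

variable {H : MultiHypergraph.{u}}

/-- The set `Q` is separated by `y` and `z` from the rest of `H`, and it is not larger than any
component of a disconnected hypergraph that arises by deleting two vertices. -/
structure IsMinSep (H : MultiHypergraph.{u}) (y z : H.V) (Q : Set H.V) : Prop where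
  ne : y ≠ z
  left_notMem : y ∉ Q
  right_notMem : z ∉ Q
  closed : ∀ q ∈ Q, ∀ x, H.Adj q x → x ∈ Q ∨ x = y ∨ x = z
  nonempty : Q.Nonempty
  outside : ∃ s, s ∉ Q ∧ s ≠ y ∧ s ≠ z
  min : ∀ y' z' r s, y' ≠ z' → r ∈ ({y', z'}ᶜ : Set H.V) → s ∈ ({y', z'}ᶜ : Set H.V) →
    s ∉ H.comp {y', z'}ᶜ r → Q.ncard ≤ (H.comp {y', z'}ᶜ r).ncard

theorem IsMinSep.symm {y z : H.V} {Q : Set H.V} (h : IsMinSep H y z Q) : IsMinSep H z y Q :=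
  ⟨h.ne.symm, h.right_notMem, h.left_notMem, fun q hq x hx => (h.closed q hq x hx).imp_right Or.symm,
    h.nonempty, h.outside.imp fun _ h => ⟨h.1, h.2.2, h.2.1⟩, h.min⟩

theorem exists_isMinSep (h : ¬ ∀ x y : H.V, x ≠ y → H.ConnOn {x, y}ᶜ) :
    ∃ y z Q, IsMinSep H y z Q := by
  classical
  let S : Set (H.V × H.V × H.V) := {t | t.1 ≠ t.2.1 ∧ t.2.2 ∈ ({t.1, t.2.1}ᶜ : Set H.V) ∧
    ∃ s ∈ ({t.1, t.2.1}ᶜ : Set H.V), s ∉ H.comp {t.1, t.2.1}ᶜ t.2.2}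
  have hS : S.Nonempty := by
    push Not at h
    obtain ⟨x, y, hxy, h⟩ := h
    unfold ConnOn at h
    push Not at h
    obtain ⟨r, hr, h⟩ := h
    obtain ⟨s, hs, hs'⟩ := Set.not_subset.1 h
    exact ⟨(x, y, r), hxy, hr, s, hs, hs'⟩
  obtain ⟨⟨y, z, r⟩, ⟨hyz, hr, s, hs, hs'⟩, hmin⟩ := Set.exists_min_image S
    (fun t => (H.comp {t.1, t.2.1}ᶜ t.2.2).ncard) (Set.toFinite _) hS
  have hsub := comp_subset (H := H) hr
  refine ⟨y, z, H.comp {y, z}ᶜ r, hyz, fun h => hsub h (by simp), fun h => hsub h (by simp),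
    fun q hq x hx => ?_, ⟨r, mem_comp_self⟩, ⟨s, hs', ?_⟩, fun y' z' r' s' h1 h2 h3 h4 =>
      hmin (y', z', r') ⟨h1, h2, s', h3, h4⟩⟩
  · by_contra! hne
    exact hne.1 (mem_comp_of_adj hq hx (by simp [hne.2]))
  · simpa using hs

/-- `H - z` is connected, and in it `Q` can be entered only from `y`, so `y` is reached before `Q`.
-/
theorem IsMinSep.reach (h2 : ∀ x, H.ConnOn {x}ᶜ) {y z : H.V} {Q : Set H.V}
    (h : IsMinSep H y z Q) {r : H.V} (hr : r ∉ Q) (hrz : r ≠ z) : y ∈ H.comp (Qᶜ \ {z}) r := by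
  have hrA : r ∈ Qᶜ \ {z} := ⟨hr, hrz⟩
  by_contra hy
  obtain ⟨a, ha, b, hb, hab, hbz, -, -⟩ :=
    comp_boundary (K := H.comp (Qᶜ \ {z}) r) mem_comp_self (h2 z r hrz h.ne) hy
  by_cases hbQ : b ∈ Q
  · have haA := comp_subset hrA ha
    rcases h.closed b hbQ a hab.symm with h' | rfl | h'
    · exact haA.1 h'
    · exact hy ha
    · exact haA.2 h'
  · exact hb (mem_comp_of_adj ha hab ⟨hbQ, hbz⟩)

theorem comp_mono {A B : Set H.V} (hAB : A ⊆ B) (r : H.V) : H.comp A r ⊆ H.comp B r := by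
  intro x hx
  induction hx with
  | refl => exact mem_comp_self
  | tail _ h ih => exact mem_comp_of_adj ih h.1 (hAB h.2)

/-- Every remaining vertex outside `Q` is still joined to `s₀` through whichever of `y`, `z` was not
deleted. A component missing `s₀` would thus lie inside `Q` without `q`, against the minimality of
`Q`. This supplies the non-separating pairs for the cycle arguments. -/
theorem IsMinSep.connOn (h2 : ∀ x, H.ConnOn {x}ᶜ) {y z : H.V} {Q : Set H.V}
    (h : IsMinSep H y z Q) {q v : H.V} (hq : q ∈ Q) (hv : v ∈ Q ∨ v = y ∨ v = z) (hqv : q ≠ v) :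
    H.ConnOn {q, v}ᶜ := by
  obtain ⟨s₀, hs₀, hs₀y, hs₀z⟩ := h.outside
  have hs₀A : s₀ ∈ ({q, v}ᶜ : Set H.V) := by
    rintro (rfl | rfl)
    · exact hs₀ hq
    · rcases hv with hv | hv | hv
      · exact hs₀ hv
      · exact hs₀y hv
      · exact hs₀z hv
  have key : ∀ x ∉ Q, x ∈ ({q, v}ᶜ : Set H.V) → s₀ ∈ H.comp {q, v}ᶜ x := by
    intro x hx hxA
    have hz : v ≠ y → x ≠ z → s₀ ∈ H.comp {q, v}ᶜ x := by
      intro hvy hxz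
      have hsub : Qᶜ \ {z} ⊆ ({q, v}ᶜ : Set H.V) → s₀ ∈ H.comp {q, v}ᶜ x := fun hsub =>
        comp_mono hsub _ (comp_trans (h.reach h2 hx hxz)
          (comp_symm ⟨hs₀, hs₀z⟩ (h.reach h2 hs₀ hs₀z)))
      apply hsub
      rintro t ⟨ht1, ht2⟩ (rfl | rfl)
      · exact ht1 hq
      · rcases hv with hv | hv | hv
        · exact ht1 hv
        · exact hvy hv
        · exact ht2 hv
    have hy : v ≠ z → x ≠ y → s₀ ∈ H.comp {q, v}ᶜ x := by
      intro hvz hxy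
      have hsub : Qᶜ \ {y} ⊆ ({q, v}ᶜ : Set H.V) → s₀ ∈ H.comp {q, v}ᶜ x := fun hsub =>
        comp_mono hsub _ (comp_trans (h.symm.reach h2 hx hxy)
          (comp_symm ⟨hs₀, hs₀y⟩ (h.symm.reach h2 hs₀ hs₀y)))
      apply hsub
      rintro t ⟨ht1, ht2⟩ (rfl | rfl)
      · exact ht1 hq
      · rcases hv with hv | hv | hv
        · exact ht1 hv
        · exact ht2 hv
        · exact hvz hv
    have hxv : x ≠ v := fun h => hxA (by simp [h])
    by_cases hvy : v = y
    · exact hy (hvy ▸ h.ne) (hvy ▸ hxv)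
    · by_cases hxz : x = z
      · exact hy (fun h' => hxv (hxz.trans h'.symm)) (hxz ▸ h.ne.symm)
      · exact hz hvy hxz
  refine connOn_of_center (r := s₀) fun t ht => ?_
  by_contra hst
  have hsub : H.comp {q, v}ᶜ t ⊆ Q \ {q} := by
    intro x hx
    have hxA := comp_subset ht hx
    refine ⟨?_, fun hxq => hxA (by simp [show x = q from hxq])⟩
    by_contra hxQ
    exact hst (comp_trans hx (key x hxQ hxA))
  have h3 := h.min q v t s₀ hqv ht hs₀A hst
  have h4 := Set.ncard_le_ncard hsub (Set.toFinite _)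
  have h5 := Set.ncard_sdiff_singleton_lt_of_mem hq (Set.toFinite Q)
  omega

end Separations

/-! ### A smallest piece is a single vertex with two neighbours -/

section Structure

variable {κ : Type v} {H : MultiHypergraph.{u}} {f : H.V → κ → ℕ} [Fintype κ] (hb : H.IsBad f)
  (h1 : H.ConnOn Set.univ) (h2 : ∀ x, H.ConnOn {x}ᶜ) {a b : κ} (hab : a ≠ b)
  (ha : ∀ x, 0 < f x a) (hb' : ∀ x, 0 < f x b)
include hb h2 hab ha hb'

theorem IsMinSep.graphAt {y z : H.V} {Q : Set H.V} (h : IsMinSep H y z Q) {q : H.V}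
    (hq : q ∈ Q) : H.GraphAt q := by
  intro e he x hx t ht hxq htq
  have hqx := adj_of_mem he hx hxq.symm
  exact ((hb.eq_or_eq_of_pair hxq.symm (h.connOn h2 hq (h.closed q hq x hqx) hxq.symm) hab (ha q)
    (hb' x) he hx ht).resolve_left htq).symm

/-- For odd `m` positions `1` and `2` must agree in colour, for even `m` positions `2` and `m`. In
either case one of the two vertices is in `Q` and the other in `Q ∪ {y, z}`, so the pair does not
separate. -/
theorem IsMinSep.cleanCycle_false {y z : H.V} {Q : Set H.V} (h : IsMinSep H y z Q) {q : H.V}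
    (hq : q ∈ Q) {p : ℕ → H.V} {m : ℕ} (hp : H.IsCleanCycle q p m) (hm : 3 ≤ m)
    (h₂ : p 2 ∈ Q ∨ p 2 = y ∨ p 2 = z) (hQ : p 1 ∈ Q ∧ p m ∈ Q ∨ p 2 ∈ Q) : False := by
  have hw := h.graphAt hb h2 hab ha hb' hq
  have h1Q : p 1 ∈ Q ∨ p 1 = y ∨ p 1 = z :=
    h.closed q hq _ (by have := hp.adj 0 (by omega); rwa [hp.zero] at this)
  have hmQ : p m ∈ Q ∨ p m = y ∨ p m = z := h.closed q hq _ hp.last.symm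
  have h12 : p 1 ≠ p 2 := fun h => by have := hp.inj _ (by omega) _ (by omega) h; omega
  have h2m : p 2 ≠ p m := fun h => by have := hp.inj _ (by omega) _ (by omega) h; omega
  by_cases hodd : m % 2 = 1
  · refine hb.cleanCycle_false hw hp (i := 1) (j := 2) (by omega) (by omega) (by omega)
      (by omega) (by omega) (Or.inr hodd) ?_ hab (ha _) (hb' _)
    rcases hQ with hQ | hQ
    · exact h.connOn h2 hQ.1 h₂ h12
    · rw [Set.pair_comm]; exact h.connOn h2 hQ h1Q h12.symm
  · refine hb.cleanCycle_false hw hp (i := 2) (j := m) (by omega) (by omega) (by omega)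
      (by omega) (by omega) (Or.inl (by omega)) ?_ hab (ha _) (hb' _)
    rcases hQ with hQ | hQ
    · rw [Set.pair_comm]; exact h.connOn h2 hQ.2 h₂ h2m.symm
    · exact h.connOn h2 hQ hmQ h2m

include h1

/-- Otherwise let `U` be the neighbours of `q` attached to the component of `y` among the
non-neighbours of `q`. Two members of `U` in `Q` would give a forbidden clean cycle, so `U` is
contained in `{x, z}` with `x` in `Q`. Then `{x, z}` cuts off from `y` a piece around `q` that is
smaller than `Q`. -/
theorem IsMinSep.adj_left {y z : H.V} {Q : Set H.V} (h : IsMinSep H y z Q) {q : H.V}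
    (hq : q ∈ Q) : H.Adj q y := by
  by_contra hqy
  have hs : y ∈ H.nonNbrs q := ⟨fun h' => h.left_notMem (h' ▸ hq), hqy⟩
  let U : Set H.V := {x | H.Adj q x ∧ ∃ a ∈ H.comp (H.nonNbrs q) y, H.Adj x a}
  have hUQ : ∀ x ∈ U, x ≠ z → x ∈ Q := by
    rintro x ⟨hx, -⟩ hxz
    rcases h.closed q hq x hx with h' | rfl | h'
    · exact h'
    · exact absurd hx hqy
    · exact absurd h' hxz
  have hU2 : ∀ x ∈ U, ∀ x' ∈ U, x ≠ x' → x = z ∨ x' = z := by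
    intro x hx x' hx' hne
    by_contra! hz
    obtain ⟨p, m, hp, hm, hp1, hpm, -⟩ := exists_cleanCycle hs hne hx hx'
    have hp1Q : p 1 ∈ Q := hp1 ▸ hUQ x hx hz.1
    exact h.cleanCycle_false hb h2 hab ha hb' hq hp hm
      (h.closed _ hp1Q _ (hp.adj 1 (by omega))) (Or.inl ⟨hp1Q, hpm ▸ hUQ x' hx' hz.2⟩)
  obtain ⟨x₁, -, hx₁⟩ := exists_attached hs (B := Set.univ) (h1 y trivial trivial)
  obtain ⟨x₂, hne, hx₂⟩ := exists_attached_pair h2 hs hx₁.1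
  obtain ⟨x, hx, hxz, hUx⟩ : ∃ x ∈ U, x ≠ z ∧ ∀ t ∈ U, t = x ∨ t = z := by
    have aux : ∀ x ∈ U, x ≠ z → ∃ x ∈ U, x ≠ z ∧ ∀ t ∈ U, t = x ∨ t = z := by
      intro x hx hxz
      refine ⟨x, hx, hxz, fun t ht => ?_⟩
      by_contra! hn
      exact (hU2 t ht x hx hn.1).elim hn.2 hxz
    by_cases hx₁z : x₁ = z
    · exact aux x₂ hx₂ (hx₁z ▸ hne)
    · exact aux x₁ hx₁ hx₁z
  have hqA : q ∈ ({x, z}ᶜ : Set H.V) := by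
    rintro (h' | h')
    · exact hx.1.1 h'
    · exact h.right_notMem ((show q = z from h') ▸ hq)
  have hyA : y ∈ ({x, z}ᶜ : Set H.V) := by
    rintro (h' | h')
    · exact hqy (h' ▸ hx.1)
    · exact h.ne h'
  -- A walk from `q` to `y` enters the component of `y` through a member of `U`, that is, through a
  -- deleted vertex.
  have hyc : y ∉ H.comp {x, z}ᶜ q := by
    intro hy
    obtain ⟨s, hs', t, ht, hst, -, hsc, -⟩ := comp_boundary (K := (H.comp (H.nonNbrs q) y)ᶜ)
      (fun h' => (comp_subset hs h').1 rfl) hy (fun h' => h' mem_comp_self)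
    rw [Set.mem_compl_iff, not_not] at ht
    have hsA := comp_subset hqA hsc
    have hsq : s ≠ q := by
      rintro rfl
      exact (comp_subset hs ht).2 hst
    by_cases hqs : H.Adj q s
    · exact hsA (hUx s ⟨hqs, t, ht, hst⟩)
    · exact hs' (mem_comp_of_adj ht hst.symm ⟨hsq, hqs⟩)
  have hsub : H.comp {x, z}ᶜ q ⊆ Q \ {x} := by
    intro t ht
    have htA := comp_subset hqA ht
    refine ⟨?_, fun h' => htA (Or.inl h')⟩
    by_contra htQ
    obtain ⟨s, hs', t', ht', hst, htA', -, htc⟩ := comp_boundary hq ht htQ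
    rcases h.closed s hs' t' hst with h' | rfl | rfl
    · exact ht' h'
    · exact hyc htc
    · exact htA' (by simp)
  have h3 := h.min x z q y hxz hqA hyA hyc
  have h4 := Set.ncard_le_ncard hsub (Set.toFinite _)
  have h5 := Set.ncard_sdiff_singleton_lt_of_mem (hUQ x hx hxz) (Set.toFinite Q)
  omega

/-- Since `y` and `z` are neighbours of `q`, the component of `q'` among the non-neighbours of `q`
stays inside `Q`; a clean cycle through it has `p 2 ∈ Q`. -/
theorem IsMinSep.adj_of_mem {y z : H.V} {Q : Set H.V} (h : IsMinSep H y z Q) {q q' : H.V}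
    (hq : q ∈ Q) (hq' : q' ∈ Q) (hne : q ≠ q') : H.Adj q q' := by
  by_contra hqq
  have hs : q' ∈ H.nonNbrs q := ⟨hne.symm, hqq⟩
  obtain ⟨x, -, hx⟩ := exists_attached hs (B := Set.univ) (h1 q' trivial trivial)
  obtain ⟨x', hne', hx'⟩ := exists_attached_pair h2 hs hx.1
  obtain ⟨p, m, hp, hm, -, -, hpA⟩ := exists_cleanCycle hs hne'.symm hx hx'
  have hsub : H.comp (H.nonNbrs q) q' ⊆ Q := by
    intro t ht
    by_contra htQ
    obtain ⟨s, hs', t', ht', hst, htA', -, -⟩ := comp_boundary hq' ht htQ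
    rcases h.closed s hs' t' hst with h' | rfl | rfl
    · exact ht' h'
    · exact htA'.2 (h.adj_left hb h1 h2 hab ha hb' hq)
    · exact htA'.2 (h.symm.adj_left hb h1 h2 hab ha hb' hq)
  have h2Q := hsub (hpA 2 (by omega) (by omega))
  exact h.cleanCycle_false hb h2 hab ha hb' hq hp hm (Or.inl h2Q) (Or.inr h2Q)

/-- A clean cycle through `q` runs outside `Q` between `y` and `z`, and forces `p 1` and `p 3` to
agree. Rotating the triangle of `q`, `q'` and `x = p 1` exchanges the colours of `q'` and `x` but
fixes `p 3`, so `q'` and `x` would always agree, although they can be coloured first with different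
colours. -/
theorem IsMinSep.subsingleton {y z : H.V} {Q : Set H.V} (h : IsMinSep H y z Q) {q q' : H.V}
    (hq : q ∈ Q) (hq' : q' ∈ Q) : q' = q := by
  by_contra hne
  obtain ⟨s, hsQ, hsy, hsz⟩ := h.outside
  have hs : s ∈ H.nonNbrs q := by
    refine ⟨fun h' => hsQ (h' ▸ hq), fun h' => ?_⟩
    rcases h.closed q hq s h' with h' | h' | h'
    · exact hsQ h'
    · exact hsy h'
    · exact hsz h'
  have hAQ : ∀ t ∈ H.comp (H.nonNbrs q) s, ¬ (t ∈ Q ∨ t = y ∨ t = z) := by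
    intro t ht h'
    have htN := comp_subset hs ht
    rcases h' with h' | rfl | rfl
    · exact htN.2 (h.adj_of_mem hb h1 h2 hab ha hb' hq h' htN.1.symm)
    · exact htN.2 (h.adj_left hb h1 h2 hab ha hb' hq)
    · exact htN.2 (h.symm.adj_left hb h1 h2 hab ha hb' hq)
  obtain ⟨x, -, hx⟩ := exists_attached hs (B := Set.univ) (h1 s trivial trivial)
  obtain ⟨x', hne', hx'⟩ := exists_attached_pair h2 hs hx.1
  have hxyz : ∀ x, H.Adj q x → (∃ a ∈ H.comp (H.nonNbrs q) s, H.Adj x a) → x = y ∨ x = z := by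
    rintro x hqx ⟨t, ht, hxt⟩
    exact (h.closed q hq x hqx).resolve_left fun hxQ => hAQ t ht (h.closed x hxQ t hxt)
  have hxx := hxyz x hx.1 hx.2
  have hxx' := hxyz x' hx'.1 hx'.2
  obtain ⟨p, m, hp, hm, hp1, hpm, hpA⟩ := exists_cleanCycle hs hne'.symm hx hx'
  have hxQ : x ∉ Q := by
    rcases hxx with rfl | rfl
    · exact h.left_notMem
    · exact h.right_notMem
  have hxQ' : x' ∉ Q := by
    rcases hxx' with rfl | rfl
    · exact h.left_notMem
    · exact h.right_notMem
  have hq'x : H.Adj q' x := by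
    rcases hxx with rfl | rfl
    · exact h.adj_left hb h1 h2 hab ha hb' hq'
    · exact h.symm.adj_left hb h1 h2 hab ha hb' hq'
  have hp3 : p 3 ≠ q' := by
    intro h3
    by_cases hm3 : m = 3
    · subst hm3
      exact hxQ' (hpm.symm.trans h3 ▸ hq')
    · exact hAQ _ (hpA 3 (by omega) (by omega)) (Or.inl (h3 ▸ hq'))
  have hp3q : p 3 ≠ q := fun h' => by
    have := hp.inj _ (by omega) 0 (by omega) (h'.trans hp.zero.symm); omega
  have hp3x : p 3 ≠ x := fun h' => by
    have := hp.inj _ (by omega) 1 (by omega) (h'.trans hp1.symm); omega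
  have hw := h.graphAt hb h2 hab ha hb' hq
  obtain ⟨φ, hφ, hφq, hφx⟩ := exists_good_of_pair hb.1 hq'x.1
    (h.connOn h2 hq' (Or.inr hxx) hq'x.1) (Ne.symm hne) hx.1.1 hab (ha q') (hb' x)
  obtain ⟨ψ, hψ, h3, h4, h5⟩ := hb.rotate_triangle hφ
    (h.adj_of_mem hb h1 h2 hab ha hb' hq hq' (Ne.symm hne)) hq'x hx.1.symm
  have e1 := hb.cleanCycle_periodic hw hφ hp (i := 1) (j := 3) le_rfl (by omega) (by omega) hm
    (Or.inl rfl)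
  have e2 := hb.cleanCycle_periodic hw hψ hp (i := 1) (j := 3) le_rfl (by omega) (by omega) hm
    (Or.inl rfl)
  rw [hp1] at e1 e2
  rw [h5 _ hp3q hp3 hp3x, ← e1, h4, hφq, hφx] at e2
  exact hab e2

end Structure

end MultiHypergraph

/-! ### A vertex with two neighbours: multiples of odd cycles -/

namespace MultiHypergraph

/-- `y` and `z` are exactly the neighbours of `q`. -/
structure IsNbrPair (H : MultiHypergraph.{u}) (q y z : H.V) : Prop where
  ne : y ≠ z
  adj_iff : ∀ x, H.Adj q x ↔ x = y ∨ x = z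

section

variable {H : MultiHypergraph.{u}} {q y z : H.V}

theorem IsNbrPair.symm (h : H.IsNbrPair q y z) : H.IsNbrPair q z y :=
  ⟨h.ne.symm, fun x => (h.adj_iff x).trans or_comm⟩

theorem IsNbrPair.left (h : H.IsNbrPair q y z) : H.Adj q y := (h.adj_iff y).2 (Or.inl rfl)

theorem IsNbrPair.right (h : H.IsNbrPair q y z) : H.Adj q z := (h.adj_iff z).2 (Or.inr rfl)

theorem IsNbrPair.of_adj (h : H.IsNbrPair q y z) {s t : H.V} (hs : H.Adj q s) (ht : H.Adj q t)
    (hst : s ≠ t) : H.IsNbrPair q s t := by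
  refine ⟨hst, fun x => (h.adj_iff x).trans ?_⟩
  rcases (h.adj_iff s).1 hs with rfl | rfl <;> rcases (h.adj_iff t).1 ht with rfl | rfl
  · exact absurd rfl hst
  · rfl
  · exact or_comm
  · exact absurd rfl hst

/-- In the connected `H - y` the only neighbour of `q` is `z`, so deleting `q` cannot disconnect. -/
theorem IsNbrPair.connOn (h : H.IsNbrPair q y z) (h2 : ∀ x, H.ConnOn {x}ᶜ) :
    H.ConnOn {q, y}ᶜ := by
  refine connOn_of_center (r := z) fun x hx => ?_
  by_contra hz
  have hxy : x ≠ y := fun h' => hx (by simp [h'])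
  obtain ⟨s, hs, t, ht, hst, hty, -, -⟩ := comp_boundary (K := H.comp {q, y}ᶜ x) mem_comp_self
    (h2 y x hxy h.left.1) (fun h' => comp_subset hx h' (by simp))
  have hsA := comp_subset hx hs
  have htq : t = q := by
    by_contra htq
    refine ht (mem_comp_of_adj hs hst ?_)
    rintro (h' | h')
    · exact htq h'
    · exact hty h'
  subst htq
  rcases (h.adj_iff s).1 hst.symm with rfl | rfl
  · exact hsA (by simp)
  · exact hz hs

theorem IsNbrPair.exists_adj_ne (h : H.IsNbrPair q y z) (h2 : ∀ x, H.ConnOn {x}ᶜ) :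
    ∃ x, x ≠ q ∧ H.Adj y x := by
  obtain ⟨s, rfl, t, -, hst, htq, -, -⟩ := comp_boundary (K := {y}) rfl
    (h2 q y h.left.1.symm h.right.1.symm) h.ne.symm
  exact ⟨t, htq, hst⟩

theorem IsNbrPair.exists_cleanCycle (h : H.IsNbrPair q y z) (h2 : ∀ x, H.ConnOn {x}ᶜ) {x : H.V}
    (hxq : x ≠ q) (hyx : H.Adj y x) :
    ∃ p m, H.IsCleanCycle q p m ∧ p 1 = y ∧ p 2 = x ∧ p m = z := by
  by_cases hxz : x = z
  · subst hxz
    exact ⟨_, 2, isCleanCycle_triangle h.left hyx h.right.symm, rfl, rfl, rfl⟩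
  have hxA : x ∈ ({q, y, z}ᶜ : Set H.V) := by simp [hxq, hxz, hyx.1.symm]
  have hx : x ∈ ({q, y}ᶜ : Set H.V) := by simp [hxq, hyx.1.symm]
  have hsub := comp_subset (H := H) hxA
  obtain ⟨s, hs, t, ht, hst, htA, -, -⟩ := comp_boundary (K := H.comp {q, y, z}ᶜ x) mem_comp_self
    (h.connOn h2 x hx (show z ∈ ({q, y}ᶜ : Set H.V) by simp [h.right.1.symm, h.ne.symm]))
    (fun h' => hsub h' (by simp))
  have htz : t = z := by
    by_contra htz
    refine ht (mem_comp_of_adj hs hst ?_)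
    simp only [Set.mem_compl_iff, Set.mem_insert_iff, Set.mem_singleton_iff] at htA ⊢
    tauto
  subst htz
  obtain ⟨p, m, hp, hm, h3, h4, h5, h6⟩ := exists_cycle_through (A := H.comp {q, y, t}ᶜ x)
    (fun h' => hsub h' (by simp)) (fun h' => hsub h' (by simp)) (fun h' => hsub h' (by simp))
    h.ne h.left h.right mem_comp_self (comp_subset_comp_comp mem_comp_self hs) hyx hst.symm
  refine ⟨p, m, ⟨hp, fun i hi him hadj => hsub (h6 i hi him) ?_⟩, h3, h4, h5⟩
  rcases (h.adj_iff _).1 hadj with h' | h' <;> simp [h']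

/-- With the hole at `q`, every usable colour must occur at one of its two neighbours; usable
colours are the same everywhere. -/
theorem IsNbrPair.two_colors {κ : Type v} {f : H.V → κ → ℕ} [Fintype κ] [Nonempty κ]
    (hb : H.IsBad f) (h1 : H.ConnOn Set.univ) (h2 : ∀ x, H.ConnOn {x}ᶜ) (h : H.IsNbrPair q y z) :
    ∃ c₁ c₂, ∀ x c, 0 < f x c → c = c₁ ∨ c = c₂ := by
  obtain ⟨φ, hφ⟩ := hb.exists_hole h1 q
  refine ⟨φ y, φ z, fun x c hc => ?_⟩
  obtain ⟨s, hs, rfl⟩ := hb.exists_adj_of_pos hφ (hb.pos_iff_pos h1 h2 hc)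
  rcases (h.adj_iff s).1 hs with rfl | rfl
  · exact Or.inl rfl
  · exact Or.inr rfl

end

section Structure

variable {κ : Type v} {H : MultiHypergraph.{u}} {f : H.V → κ → ℕ} [Fintype κ] (hb : H.IsBad f)
  (h1 : H.ConnOn Set.univ) (h2 : ∀ x, H.ConnOn {x}ᶜ) {a b : κ} (hab : a ≠ b)
  (ha : ∀ x, 0 < f x a) (hb' : ∀ x, 0 < f x b) {q y z : H.V}
include hb hab ha hb'

theorem IsNbrPair.color_ne (h : H.IsNbrPair q y z) {φ : H.V → κ} (hφ : H.IsGood f {q}ᶜ φ) :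
    φ y ≠ φ z := by
  obtain ⟨s, hs, hsa⟩ := hb.exists_adj_of_pos hφ (ha q)
  obtain ⟨t, ht, htb⟩ := hb.exists_adj_of_pos hφ (hb' q)
  intro hyz
  have : ∀ x, H.Adj q x → φ x = φ z := fun x hx => by
    rcases (h.adj_iff x).1 hx with rfl | rfl
    · exact hyz
    · rfl
  exact hab (hsa.symm.trans ((this s hs).trans ((this t ht).symm.trans htb)))

include h2

theorem IsNbrPair.graphAt (h : H.IsNbrPair q y z) : H.GraphAt q := by
  intro e he x hx t ht hxq htq
  have hqx := adj_of_mem he hx hxq.symm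
  have hc : H.ConnOn {q, x}ᶜ := by
    rcases (h.adj_iff x).1 hqx with rfl | rfl
    · exact h.connOn h2
    · exact h.symm.connOn h2
  exact ((hb.eq_or_eq_of_pair hxq.symm hc hab (ha q) (hb' x) he hx ht).resolve_left htq).symm

/-- Shift the hole from `y` to `q`, so that `y` takes the colour of `q`. A clean cycle `q, y, x, …,
z` makes `x` and `z` agree, while `y` and `z` must differ. -/
theorem IsNbrPair.color_ne_of_adj (h : H.IsNbrPair q y z) {φ : H.V → κ} (hφ : H.IsGood f {y}ᶜ φ)
    {x : H.V} (hxq : x ≠ q) (hyx : H.Adj y x) : φ x ≠ φ q := by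
  classical
  have hψ := hb.shift hφ h.left.symm
  obtain ⟨p, m, hp, h3, h4, h5⟩ := h.exists_cleanCycle h2 hxq hyx
  have h6 := (hb.cleanCycle_aux (h.graphAt hb h2 hab ha hb') hψ hp).1
  have h7 := h.color_ne hb hab ha hb' hψ
  rw [h4, h5] at h6
  rw [← h6, Function.update_self, Function.update_of_ne hyx.1.symm] at h7
  exact h7.symm

theorem IsNbrPair.mult_eq (h : H.IsNbrPair q y z) [Nonempty κ] (h1 : H.ConnOn Set.univ) :
    H.mult q y = H.mult q z := by
  obtain ⟨φ, hφ⟩ := hb.exists_hole h1 q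
  obtain ⟨x, hxq, hyx⟩ := h.exists_adj_ne h2
  obtain ⟨p, m, hp, h3, h4, h5⟩ := h.exists_cleanCycle h2 hxq hyx
  have h6 := (hb.cleanCycle_aux (h.graphAt hb h2 hab ha hb') hφ hp).2
  rw [h3, h5] at h6
  exact h6 (h.color_ne hb hab ha hb' hφ)

/-- With the hole at `q`, the colour of `y` occurs at no other neighbour, so its exhausted capacity
is the multiplicity. This later identifies the multiplicity with `r`. -/
theorem IsNbrPair.exists_eq_mult (h : H.IsNbrPair q y z) [Nonempty κ]
    (h1 : H.ConnOn Set.univ) : ∃ c, f q c = H.mult q y := by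
  obtain ⟨φ, hφ⟩ := hb.exists_hole h1 q
  refine ⟨φ y, ?_⟩
  rw [← hb.colorDeg_eq hφ]
  unfold colorDeg mult
  congr 1
  ext e
  constructor
  · rintro ⟨he, h3⟩
    obtain ⟨t, ht, htq⟩ := exists_mem_ne e q
    rcases (h.adj_iff t).1 (adj_of_mem he ht htq.symm) with rfl | rfl
    · exact ⟨he, ht⟩
    · exact absurd (h3 _ ht htq).2.symm (h.color_ne hb hab ha hb' hφ)
  · rintro ⟨he, hy⟩
    refine ⟨he, fun t ht htq => ⟨htq, ?_⟩⟩
    rw [h.graphAt hb h2 hab ha hb' e he t ht y hy htq h.left.1.symm]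

include h1

/-- With only two colours and the hole at `y`, all neighbours of `y` other than `q` have the colour
different from that of `q`. Given two of them, a rotation through `q` and one of them, ending at it,
hands it the colour of `q` while the other keeps its own, which breaks this pattern. -/
theorem IsNbrPair.unique_adj (h : H.IsNbrPair q y z) [Nonempty κ] {x x' : H.V} (hxq : x ≠ q)
    (hx : H.Adj y x) (hxq' : x' ≠ q) (hx' : H.Adj y x') : x = x' := by
  by_contra hne
  obtain ⟨c₁, c₂, hc⟩ := IsNbrPair.two_colors hb h1 h2 h
  have two : ∀ {φ : H.V → κ}, H.IsGood f {y}ᶜ φ → ∀ s t r, s ≠ y → t ≠ y → r ≠ y →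
      φ s ≠ φ r → φ t ≠ φ r → φ s = φ t := by
    intro φ hφ s t r hs ht hr h3 h4
    have h5 := hc s _ (hφ.pos (x := s) hs)
    have h6 := hc t _ (hφ.pos (x := t) ht)
    have h7 := hc r _ (hφ.pos (x := r) hr)
    rcases h5 with h5 | h5 <;> rcases h6 with h6 | h6 <;> rcases h7 with h7 | h7 <;>
      simp_all
  obtain ⟨φ, hφ⟩ := hb.exists_hole h1 y
  have hqy := h.left.1
  -- a rotation that exchanges the colours of `q` and `s` only is impossible
  have aux : ∀ s t, s ≠ q → t ≠ q → s ≠ t → H.Adj y s → H.Adj y t → ∀ ψ : H.V → κ,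
      H.IsGood f {y}ᶜ ψ → ψ s = φ q → ψ t = φ t → False := by
    intro s t hs ht _ hys hyt ψ hψ h3 h4
    have e1 := h.color_ne_of_adj hb h2 hab ha hb' hφ ht hyt
    have e2 := h.color_ne_of_adj hb h2 hab ha hb' hψ hs hys
    have e3 := h.color_ne_of_adj hb h2 hab ha hb' hψ ht hyt
    have e4 := two hψ s t q hys.1.symm hyt.1.symm hqy e2 e3
    rw [h3, h4] at e4
    exact e1 e4.symm
  by_cases hyz : H.Adj y z
  · obtain ⟨t, htq, hyt, htz⟩ : ∃ t, t ≠ q ∧ H.Adj y t ∧ t ≠ z := by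
      by_cases hxz : x = z
      · exact ⟨x', hxq', hx', fun h' => hne (hxz.trans h'.symm)⟩
      · exact ⟨x, hxq, hx, hxz⟩
    obtain ⟨ψ, hψ, -, h4, h5⟩ := hb.rotate_triangle hφ h.left.symm h.right hyz.symm
    exact aux z t h.right.1.symm htq htz.symm hyz hyt ψ hψ h4 (h5 t hyt.1.symm htq htz)
  · have hs : z ∈ H.nonNbrs y := ⟨h.ne.symm, hyz⟩
    have hqU : H.Adj y q ∧ ∃ a ∈ H.comp (H.nonNbrs y) z, H.Adj q a :=
      ⟨h.left.symm, z, mem_comp_self, h.right⟩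
    obtain ⟨s, hsq, hsU⟩ := exists_attached_pair h2 hs hqU.1
    obtain ⟨p, m, hp, hm, hp1, hpm, hpA⟩ := MultiHypergraph.exists_cleanCycle hs hsq.symm hqU hsU
    obtain ⟨t, htq, hyt, hts⟩ : ∃ t, t ≠ q ∧ H.Adj y t ∧ t ≠ s := by
      by_cases hxz : x = s
      · exact ⟨x', hxq', hx', fun h' => hne (hxz.trans h'.symm)⟩
      · exact ⟨x, hxq, hx, hxz⟩
    obtain ⟨ψ, hψ, -, h4, h5⟩ := hb.rotate hφ p (by omega) hp.zero hp.inj hp.adj hp.last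
    rw [hpm, hp1] at h4
    refine aux s t hsq htq hts.symm hsU.1 hyt ψ hψ h4 (h5 t fun i hi h' => ?_)
    by_cases hi0 : i = 0
    · rw [hi0, hp.zero] at h'; exact hyt.1 h'.symm
    by_cases hi1 : i = 1
    · rw [hi1, hp1] at h'; exact htq h'
    by_cases him : i = m
    · rw [him, hpm] at h'; exact hts h'
    · exact hp.clean i (by omega) (by omega) (h' ▸ hyt)

theorem IsNbrPair.exists_next (h : H.IsNbrPair q y z) [Nonempty κ] : ∃ x, H.IsNbrPair y q x := by
  obtain ⟨x, hxq, hyx⟩ := h.exists_adj_ne h2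
  refine ⟨x, hxq.symm, fun t => ⟨fun ht => ?_, ?_⟩⟩
  · by_cases htq : t = q
    · exact Or.inl htq
    · exact Or.inr (h.unique_adj hb h1 h2 hab ha hb' htq ht hxq hyx)
  · rintro (rfl | rfl)
    · exact h.left.symm
    · exact hyx

theorem IsNbrPair.forall_exists (h : H.IsNbrPair q y z) [Nonempty κ] (w : H.V) :
    ∃ s t, H.IsNbrPair w s t := by
  have hw := h1 q trivial (Set.mem_univ w)
  induction hw with
  | refl => exact ⟨y, z, h⟩
  | @tail v w _ hvw ih =>
    obtain ⟨s, t, hst⟩ := ih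
    rcases (hst.adj_iff w).1 hvw.1 with rfl | rfl
    · exact ⟨v, hst.exists_next hb h1 h2 hab ha hb'⟩
    · exact ⟨v, hst.symm.exists_next hb h1 h2 hab ha hb'⟩

/-- If some vertex has exactly two neighbours, then `H` is a multiple of an odd cycle. -/
theorem IsNbrPair.cycle (h : H.IsNbrPair q y z) [Nonempty κ] :
    (∀ w, H.GraphAt w) ∧ (∀ w, ∃ s t, H.IsNbrPair w s t) ∧
    ∃ p m t c, H.IsCycle q p m ∧ m % 2 = 0 ∧ (∀ w, ∃ i ≤ m, p i = w) ∧
      (∀ x y, H.Adj x y → H.mult x y = t) ∧ f q c = t := by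
  have hall := fun w => h.forall_exists hb h1 h2 hab ha hb' w
  obtain ⟨x, hxq, hyx⟩ := h.exists_adj_ne h2
  obtain ⟨p, m, hp, hp1, hp2, hpm⟩ := h.exists_cleanCycle h2 hxq hyx
  have hm := hp.two_le
  obtain ⟨c, hc⟩ := h.exists_eq_mult hb h2 hab ha hb' h1
  have hconst : ∀ w s t, H.Adj w s → H.Adj w t → H.mult w s = H.mult w t := by
    intro w s t hs ht
    by_cases hst : s = t
    · rw [hst]
    · obtain ⟨s', t', hw⟩ := hall w
      exact (hw.of_adj hs ht hst).mult_eq hb h2 hab ha hb' h1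
  refine ⟨fun w => ?_, hall, p, m, H.mult q y, c, hp.toIsCycle, ?_, fun w => ?_,
    fun s t hst => ?_, hc⟩
  · obtain ⟨s, t, hw⟩ := hall w
    exact hw.graphAt hb h2 hab ha hb'
  · obtain ⟨φ, hφ⟩ := hb.exists_hole h1 q
    have hne := h.color_ne hb hab ha hb' hφ
    by_contra hodd
    have := hb.cleanCycle_periodic (h.graphAt hb h2 hab ha hb') hφ hp (i := 1) (j := m) le_rfl
      (by omega) (by omega) le_rfl (Or.inr (by omega))
    rw [hp1, hpm] at this
    exact hne this
  · have hw := h1 q trivial (Set.mem_univ w)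
    induction hw with
    | refl => exact ⟨0, by omega, hp.zero⟩
    | @tail v w _ hvw ih =>
      obtain ⟨i, hi, rfl⟩ := ih
      obtain ⟨s', t', hw⟩ := hall (p i)
      -- Each vertex has two neighbours, and those of `p i` already lie on the cycle, so a walk
      -- cannot leave the cycle.
      have fin : ∀ j k, j ≤ m → k ≤ m → j ≠ k → H.Adj (p i) (p j) → H.Adj (p i) (p k) →
          ∃ i ≤ m, p i = w := by
        intro j k hj hk hjk h3 h4
        rcases ((hw.of_adj h3 h4 fun h' => hjk (hp.inj _ hj _ hk h')).adj_iff w).1 hvw.1 with h | h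
        · exact ⟨j, hj, h.symm⟩
        · exact ⟨k, hk, h.symm⟩
      by_cases hi0 : i = 0
      · subst hi0
        refine fin 1 m (by omega) le_rfl (by omega) (hp.adj 0 (by omega)) ?_
        rw [hp.zero]; exact hp.last.symm
      have hprev : H.Adj (p i) (p (i - 1)) := by
        have := hp.adj (i - 1) (by omega)
        rw [show i - 1 + 1 = i by omega] at this
        exact this.symm
      by_cases him : i = m
      · subst him
        exact fin (i - 1) 0 (by omega) (by omega) (by omega) hprev (by rw [hp.zero]; exact hp.last)
      · exact fin (i - 1) (i + 1) (by omega) (by omega) (by omega) hprev (hp.adj i (by omega))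
  · have key : ∀ s t, H.Adj s t → H.mult s t = H.mult q y := by
      intro s
      have hs := h1 q trivial (Set.mem_univ s)
      induction hs with
      | refl => exact fun t ht => hconst _ _ _ ht h.left
      | @tail v w _ hvw ih =>
        intro t ht
        rw [hconst w t v ht hvw.1.symm, mult_comm, ih w hvw.1]
    exact key s t hst

/-- A bad hypergraph without cut-vertices that uses at least two colours is a multiple of a complete
graph or of an odd cycle. -/
theorem IsBad.complete_or_cycle [Nonempty κ] :
    (∀ w, H.GraphAt w) ∧
    (((∀ x y, x ≠ y → H.Adj x y) ∧ ∃ t, 1 ≤ t ∧ ∀ x y, x ≠ y → H.mult x y = t) ∨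
    (∀ w, ∃ s t, H.IsNbrPair w s t) ∧
    ∃ q p m t c, H.IsCycle q p m ∧ m % 2 = 0 ∧ (∀ w, ∃ i ≤ m, p i = w) ∧
      (∀ x y, H.Adj x y → H.mult x y = t) ∧ f q c = t) := by
  by_cases hp : ∀ x y : H.V, x ≠ y → H.ConnOn {x, y}ᶜ
  · obtain ⟨h3, h4, h5⟩ := hb.complete_of_pairs h1 h2 hp hab ha hb'
    exact ⟨h3, Or.inl ⟨h4, h5⟩⟩
  · obtain ⟨y, z, Q, hQ⟩ := exists_isMinSep hp
    obtain ⟨q, hq⟩ := hQ.nonempty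
    have hn : H.IsNbrPair q y z := by
      refine ⟨hQ.ne, fun x => ⟨fun hx => (hQ.closed q hq x hx).resolve_left fun hxQ => ?_, ?_⟩⟩
      · exact hx.1 (hQ.subsingleton hb h1 h2 hab ha hb' hq hxQ).symm
      · rintro (rfl | rfl)
        · exact hQ.adj_left hb h1 h2 hab ha hb' hq
        · exact hQ.symm.adj_left hb h1 h2 hab ha hb' hq
    obtain ⟨h3, h4, h5⟩ := hn.cycle hb h1 h2 hab ha hb'
    exact ⟨h3, Or.inr ⟨h4, q, h5⟩⟩

end Structure

end MultiHypergraph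

namespace MultiHypergraph

/-! ### Degrees in induced subhypergraphs and in multigraphs -/

section Induce

variable {H : MultiHypergraph.{u}}

theorem degIn_univ (x : H.V) : H.degIn Set.univ x = H.degree x := by
  unfold degIn degree; congr 1; ext e; simp

theorem subset_of_degree_le_degIn {Y : Set H.V} {x : H.V} (h : H.degree x ≤ H.degIn Y x) {e : H.E}
    (he : x ∈ H.inc e) : H.inc e ⊆ Y := by
  have := Set.eq_of_subset_of_ncard_le (s := {e | x ∈ H.inc e ∧ H.inc e ⊆ Y})
    (t := {e | x ∈ H.inc e}) (fun _ h => h.1) h (Set.toFinite _)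
  exact (this.ge (show e ∈ {e | x ∈ H.inc e} from he)).2

theorem degIn_induce (X : Set H.V) (Y : Set (H.induce X).V) (x : (H.induce X).V) :
    (H.induce X).degIn Y x = H.degIn ((Subtype.val : X → H.V) '' Y) x.1 := by
  refine (Set.ncard_image_of_injective _
    (Subtype.val_injective (p := fun e : H.E => H.inc e ⊆ X))).symm.trans ?_
  unfold degIn
  congr 1
  ext e
  constructor
  · rintro ⟨e, ⟨h1, h2⟩, rfl⟩
    exact ⟨h1, fun y hy => ⟨⟨y, e.2 hy⟩, h2 hy, rfl⟩⟩
  · rintro ⟨h1, h2⟩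
    have he : H.inc e ⊆ X := h2.trans (by rintro _ ⟨y, -, rfl⟩; exact y.2)
    refine ⟨⟨e, he⟩, ⟨h1, fun y hy => ?_⟩, rfl⟩
    obtain ⟨y', hy', h⟩ := h2 hy
    rwa [← Subtype.ext h]

theorem degree_induce (X : Set H.V) (x : (H.induce X).V) :
    (H.induce X).degree x = H.degIn X x.1 := by
  rw [← degIn_univ, degIn_induce]
  congr 1
  exact Set.image_univ.trans Subtype.range_val

theorem degree_eq_of_isNbrPair {w y z : H.V} (hw : H.GraphAt w) (h : H.IsNbrPair w y z) :
    H.degree w = H.mult w y + H.mult w z := by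
  unfold degree mult
  rw [← Set.ncard_union_eq _ (Set.toFinite _) (Set.toFinite _)]
  · congr 1
    ext e
    constructor
    · intro he
      obtain ⟨t, ht, htw⟩ := exists_mem_ne e w
      rcases (h.adj_iff t).1 (adj_of_mem he ht htw.symm) with rfl | rfl
      · exact Or.inl ⟨he, ht⟩
      · exact Or.inr ⟨he, ht⟩
    · rintro (he | he) <;> exact he.1
  · rw [Set.disjoint_left]
    rintro e ⟨he, h1⟩ ⟨-, h2⟩
    exact h.ne (hw e he y h1 z h2 h.left.1.symm h.right.1.symm)

theorem degree_eq_of_mult_eq {w : H.V} (hw : H.GraphAt w) {t : ℕ}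
    (ht : ∀ x, w ≠ x → H.mult w x = t) : H.degree w = (Nat.card H.V - 1) * t := by
  classical
  have := Fintype.ofFinite H.V
  -- With a single colour, `colorDeg` is the degree, so the count by neighbours applies.
  have h1 : H.degree w = H.colorDeg {w}ᶜ (fun _ => ()) w () := by
    unfold degree colorDeg; congr 1; ext e; simp
  rw [h1, colorDeg_eq_sum hw, ← Finset.sum_filter]
  rw [Finset.sum_congr rfl fun x hx => ht x (Finset.mem_filter.1 hx).2.1.symm]
  simp [Finset.filter_ne']

end Induce

/-! ### Excluding cut-vertices -/

section LeafBlock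

variable {κ : Type v} {H : MultiHypergraph.{u}} {f : H.V → κ → ℕ} [Fintype κ]

theorem mem_comp_induce {B A : Set H.V} (hA : A ⊆ B)
    (hadj : ∀ x y : B, H.Adj x y → (H.induce B).Adj x y) {A' : Set (H.induce B).V}
    (hA' : ∀ z : (H.induce B).V, z.1 ∈ A → z ∈ A') (r : (H.induce B).V) (hr : r.1 ∈ A) {x : H.V}
    (hx : x ∈ H.comp A r.1) :
    ∀ hxB : x ∈ B, (⟨x, hxB⟩ : (H.induce B).V) ∈ (H.induce B).comp A' r := by
  induction hx with
  | refl => exact fun _ => mem_comp_self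
  | @tail y z hy h ih =>
    intro hz
    have hyB := hA (comp_subset hr hy)
    exact mem_comp_of_adj (ih hyB) (hadj ⟨y, hyB⟩ ⟨z, hz⟩ h.1) (hA' _ h.2)

/-- Restricting a bad hypergraph to a set `B`, after greedily colouring the other vertices,
when every edge meeting `B` lies in `B` or has only one vertex in `B`. -/
theorem IsBad.induce (hb : H.IsBad f) {B : Set H.V} {φ : H.V → κ} (hφ : H.IsGood f Bᶜ φ)
    (hB : ∀ e, ∀ x ∈ H.inc e, x ∈ B → ∀ y ∈ H.inc e, y ∈ B → x ≠ y → H.inc e ⊆ B) :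
    (H.induce B).IsBad fun x c => f x.1 c - H.colorDeg Bᶜ φ x.1 c := by
  classical
  refine ⟨fun x => ?_, ?_⟩
  · have h1 : (∑ c, H.colorDeg Bᶜ φ x.1 c) ≤ ({e | x.1 ∈ H.inc e} \ {e | H.inc e ⊆ B}).ncard := by
      refine sum_ncard_le _ (fun e => x.1 ∈ H.inc e ∧ ¬ H.inc e ⊆ B) colorDeg_uniq ?_
      rintro c e ⟨he, h⟩
      refine ⟨he, fun hsub => ?_⟩
      obtain ⟨y, hy, hyx⟩ := exists_mem_ne e x.1
      exact (h y hy hyx).1 (hsub hy)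
    have h2 := Set.ncard_inter_add_ncard_sdiff_eq_ncard {e | x.1 ∈ H.inc e} {e | H.inc e ⊆ B}
      (Set.toFinite _)
    have h3 : (H.induce B).degree x = ({e | x.1 ∈ H.inc e} ∩ {e | H.inc e ⊆ B}).ncard :=
      degree_induce B x
    have h4 : ({e | x.1 ∈ H.inc e}).ncard ≤ ∑ c, f x.1 c := hb.1 x.1
    have h5 : ∑ c, f x.1 c ≤ ∑ c, ((f x.1 c - H.colorDeg Bᶜ φ x.1 c) + H.colorDeg Bᶜ φ x.1 c) :=
      Finset.sum_le_sum fun c _ => le_tsub_add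
    rw [Finset.sum_add_distrib] at h5
    change (H.induce B).degree x ≤ ∑ c, (f x.1 c - H.colorDeg Bᶜ φ x.1 c)
    omega
  · rintro ⟨ψ, hψ⟩
    let θ : H.V → κ := fun x => if h : x ∈ B then ψ ⟨x, h⟩ else φ x
    have hθB : ∀ x : B, θ x = ψ x := fun x => dif_pos x.2
    have hθ : ∀ x ∉ B, θ x = φ x := fun x hx => dif_neg hx
    refine hb.2 ⟨θ, fun Y _ hne c hc => ?_⟩
    by_cases hYB : Y ⊆ Bᶜ
    · exact hφ Y hYB hne c fun y hy => (hθ y (hYB hy)).symm.trans (hc y hy)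
    obtain ⟨x₀, hx₀, hx₀B⟩ := Set.not_subset.1 hYB
    rw [Set.mem_compl_iff, not_not] at hx₀B
    obtain ⟨x, hx, hlt⟩ := hψ (Subtype.val ⁻¹' Y) (Set.subset_univ _) ⟨⟨x₀, hx₀B⟩, hx₀⟩ c
      fun y hy => (hθB y).symm.trans (hc y.1 hy)
    refine ⟨x.1, hx, ?_⟩
    have h1 := degIn_induce B (Subtype.val ⁻¹' Y) x
    -- An edge at `x` inside `Y` either lies in `B` or, by `hB`, has no other vertex in `B` and is
    -- counted by `colorDeg`.
    have h2 : H.degIn Y x.1 ≤ H.degIn (Subtype.val '' (Subtype.val ⁻¹' Y : Set B)) x.1 +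
        H.colorDeg Bᶜ φ x.1 c := by
      refine le_trans (Set.ncard_le_ncard ?_ (Set.toFinite _)) (Set.ncard_union_le _ _)
      rintro e ⟨he, heY⟩
      by_cases heB : H.inc e ⊆ B
      · exact Or.inl ⟨he, fun y hy => ⟨⟨y, heB hy⟩, heY hy, rfl⟩⟩
      · refine Or.inr ⟨he, fun y hy hyx => ?_⟩
        have hyB : y ∉ B := fun hyB => heB (hB e x.1 he x.2 y hy hyB hyx.symm)
        exact ⟨hyB, (hθ y hyB).symm.trans (hc y (heY hy))⟩
    exact h2.trans_lt (lt_tsub_iff_right.1 (h1.symm.trans_lt hlt))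

variable [Nonempty κ]

/-- Under the assumptions of `IsBad.complete_or_cycle`, the hypergraph is regular. -/
theorem IsBad.degree_eq_degree (hb : H.IsBad f) (h1 : H.ConnOn Set.univ)
    (h2 : ∀ x, H.ConnOn {x}ᶜ) {a b : κ} (hab : a ≠ b) (ha : ∀ x, 0 < f x a)
    (hb' : ∀ x, 0 < f x b) (x y : H.V) : H.degree x = H.degree y := by
  obtain ⟨hg, ⟨-, t, -, ht⟩ | ⟨h3, -, -, -, t, -, -, -, -, ht, -⟩⟩ :=
    hb.complete_or_cycle h1 h2 hab ha hb'
  · rw [degree_eq_of_mult_eq (hg x) (ht x), degree_eq_of_mult_eq (hg y) (ht y)]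
  · have : ∀ x, H.degree x = t + t := fun x => by
      obtain ⟨s, r, hx⟩ := h3 x
      rw [degree_eq_of_isNbrPair (hg x) hx, ht _ _ hx.left, ht _ _ hx.right]
    rw [this, this]

/-- A connected bad hypergraph in which every vertex has the same number of colours, counted with
`f`, and uses at least two of them, has no cut-vertex. -/
theorem IsBad.connOn_compl_singleton (hb : H.IsBad f) (h1 : H.ConnOn Set.univ) {K : ℕ}
    (hK : ∀ x, ∑ c, f x c = K) (h2c : ∀ x, ∃ a b, a ≠ b ∧ 0 < f x a ∧ 0 < f x b) (w : H.V) :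
    H.ConnOn {w}ᶜ := by
  classical
  have hnbr : ∃ s, s ≠ w := by
    obtain ⟨φ, hφ⟩ := hb.exists_hole h1 w
    obtain ⟨a, -, -, ha, -⟩ := h2c w
    obtain ⟨s, hs, -⟩ := hb.exists_adj_of_pos hφ ha
    exact ⟨s, hs.1.symm⟩
  -- Among all components of all `H - x`, take a smallest one. Together with `x` it plays the part
  -- of a leaf block, whether or not `x` is a cut-vertex.
  obtain ⟨⟨x, s⟩, hsx, hmin⟩ := Set.exists_min_image {t : H.V × H.V | t.2 ≠ t.1}
    (fun t => (H.comp {t.1}ᶜ t.2).ncard) (Set.toFinite _) (hnbr.imp' (fun s => (w, s)) fun _ h => h)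
  change s ≠ x at hsx
  let B₀ := H.comp {x}ᶜ s
  let B := insert x B₀
  have hsB₀ : s ∈ B₀ := mem_comp_self
  have hxB₀ : x ∉ B₀ := fun h => comp_subset (H := H) (A := {x}ᶜ) hsx h rfl
  have hclosed : ∀ y ∈ B₀, ∀ t, H.Adj y t → t ∈ B := by
    intro y hy t ht
    by_cases htx : t = x
    · exact Or.inl htx
    · exact Or.inr (mem_comp_of_adj hy ht htx)
  have hedge : ∀ e, ∀ y ∈ H.inc e, y ∈ B₀ → H.inc e ⊆ B := by
    intro e y hy hyB t ht
    by_cases hyt : y = t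
    · exact hyt ▸ Or.inr hyB
    · exact hclosed y hyB t (adj_of_mem hy ht hyt)
  have hB : ∀ e, ∀ y ∈ H.inc e, y ∈ B → ∀ t ∈ H.inc e, t ∈ B → y ≠ t → H.inc e ⊆ B := by
    rintro e y hy (rfl | hyB) t ht (rfl | htB) hyt
    · exact absurd rfl hyt
    · exact hedge e t ht htB
    · exact hedge e y hy hyB
    · exact hedge e y hy hyB
  have hadj : ∀ y t : B, H.Adj y t → (H.induce B).Adj y t := by
    rintro y t ⟨hne, e, hy, ht⟩
    exact ⟨fun h => hne (congrArg _ h), ⟨e, hB e y hy y.2 t ht t.2 hne⟩, hy, ht⟩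
  have hreach : ∀ A : Set H.V, ∀ t, t ∈ B \ A → x ∈ H.comp Aᶜ t → x ∈ H.comp (B \ A) t := by
    intro A t ht hxt
    by_contra hx
    obtain ⟨y, hy, z, hz, hyz, hzA, -, -⟩ :=
      comp_boundary (K := H.comp (B \ A) t) mem_comp_self hxt hx
    have hyB := comp_subset ht hy
    rcases hyB.1 with rfl | hyB₀
    · exact hx hy
    · exact hz (mem_comp_of_adj hy hyz ⟨hclosed y hyB₀ z hyz, hzA⟩)
  -- The block has no cut-vertex: a component of `H - y` missing `x` would fit into `B₀` without
  -- `y`, against minimality.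
  have hconn : ∀ y ∈ B, H.ConnOn (B \ {y}) := by
    rintro y (rfl | hy)
    · have hBy : B \ {y} = B₀ := by simp [B, hxB₀]
      rw [hBy]
      exact connOn_of_center' hsB₀ (comp_subset_comp_comp mem_comp_self)
    · refine connOn_of_center (r := x) fun t ht => hreach {y} t ht ?_
      have hxy : x ≠ y := fun h => hxB₀ (h ▸ hy)
      rcases ht.1 with rfl | htB
      · exact mem_comp_self
      by_contra hxt
      have hty : t ≠ y := ht.2
      have hsub : H.comp {y}ᶜ t ⊆ B₀ \ {y} := by
        intro z hz
        refine ⟨?_, comp_subset (H := H) (A := {y}ᶜ) hty hz⟩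
        by_contra hzB
        obtain ⟨p, hp, q, hq, hpq, -, -, hqc⟩ := comp_boundary htB hz hzB
        rcases hclosed p hp q hpq with rfl | h
        · exact hxt hqc
        · exact hq h
      have h3 := hmin (y, t) hty
      have h4 := Set.ncard_le_ncard hsub (Set.toFinite _)
      have h5 := Set.ncard_sdiff_singleton_lt_of_mem hy (Set.toFinite B₀)
      change B₀.ncard ≤ (H.comp {y}ᶜ t).ncard at h3
      omega
  obtain ⟨φ, hφ⟩ : ∃ φ, H.IsGood f Bᶜ φ := by
    obtain ⟨c⟩ := ‹Nonempty κ›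
    obtain ⟨φ, hφ, -⟩ := exists_good_extend hb.1 (T₀ := B) (T := Set.univ) (φ := fun _ => c)
      (by rw [Set.compl_univ]; exact isGood_empty _) (Set.subset_univ _) fun T' h3 h4 => by
        obtain ⟨y, -, hy⟩ := Set.exists_of_ssubset h4
        obtain ⟨p, hp, q, hq, hpq, -, -, -⟩ :=
          comp_boundary (h3 (Set.mem_insert x B₀)) (h1 x trivial (Set.mem_univ y)) hy
        exact ⟨q, ⟨trivial, hq⟩, p, hp, hpq.symm⟩
    exact ⟨φ, hφ⟩
  have hb₁ := hb.induce hφ hB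
  have hc1 : (H.induce B).ConnOn Set.univ := by
    have hBc : H.ConnOn B := by
      refine connOn_of_center (r := x) fun t ht => ?_
      have := hreach ∅ t (by simpa using ht) (by simpa using h1 t trivial (Set.mem_univ x))
      simpa using this
    rintro r - t -
    exact mem_comp_induce subset_rfl hadj (fun _ _ => trivial) r r.2 (hBc r.1 r.2 t.2) t.2
  have hc2 : ∀ y : B, (H.induce B).ConnOn ({y}ᶜ : Set B) := by
    rintro y r hr t ht
    have hne : ∀ z : B, z ∈ ({y}ᶜ : Set B) → z.1 ∈ B \ {y.1} := fun z hz =>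
      ⟨z.2, fun h => hz (Subtype.ext h)⟩
    refine mem_comp_induce Set.sdiff_subset hadj ?_ r (hne r hr)
      (hconn y.1 y.2 r.1 (hne r hr) (hne t ht)) t.2
    rintro z h rfl
    exact h.2 rfl
  have hsf : ∀ c, H.colorDeg Bᶜ φ s c = 0 := by
    intro c
    rw [colorDeg, Set.ncard_eq_zero (Set.toFinite _), Set.eq_empty_iff_forall_notMem]
    rintro e ⟨he, h⟩
    obtain ⟨y, hy, hys⟩ := exists_mem_ne e s
    exact (h y hy hys).1 (hedge e s he hsB₀ hy)
  obtain ⟨a, b, hab, ha, hb'⟩ := h2c s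
  let sB : (H.induce B).V := ⟨s, Or.inr hsB₀⟩
  let xB : (H.induce B).V := ⟨x, Or.inl rfl⟩
  have hpos : ∀ c, 0 < f s c → ∀ y : (H.induce B).V, 0 < f y.1 c - H.colorDeg Bᶜ φ y.1 c := by
    intro c hc y
    refine hb₁.pos_iff_pos hc1 hc2 (x := sB) ?_
    change 0 < f s c - H.colorDeg Bᶜ φ s c
    rw [hsf]; exact hc
  have hdeg : (H.induce B).degree xB = (H.induce B).degree sB :=
    hb₁.degree_eq_degree hc1 hc2 hab (hpos a ha) (hpos b hb') xB sB
  rw [degree_induce, degree_induce] at hdeg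
  -- All edges at `s` lie in `B`, so its degree there is its full degree `K`. Regularity of the
  -- block carries this over to `x`, which has no edges left to leave `B`.
  have hs : H.degIn B s = K := by
    obtain ⟨φ, hφ⟩ := hb.exists_hole h1 s
    rw [← hK s, ← hb.degree_eq hφ]
    unfold degIn degree
    congr 1
    ext e
    exact and_iff_left_of_imp fun he => hedge e s he hsB₀
  have hx : H.degree x ≤ H.degIn B x := by
    have h3 : H.degIn B x = H.degIn B s := hdeg
    rw [h3, hs, ← hK x]
    exact hb.1 x
  have hBu : B = Set.univ := by
    refine Set.eq_univ_of_forall fun t => ?_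
    by_contra ht
    obtain ⟨p, hp, q, hq, ⟨-, e, hpe, hqe⟩, -⟩ :=
      comp_boundary (Set.mem_insert x B₀) (h1 x trivial (Set.mem_univ t)) ht
    rcases hp with rfl | hp
    · exact hq (subset_of_degree_le_degIn hx hpe hqe)
    · exact hq (hedge e p hpe hp hqe)
  have := hconn w (hBu ▸ Set.mem_univ w)
  rwa [hBu, ← Set.compl_eq_univ_sdiff] at this

end LeafBlock

end MultiHypergraph

namespace MultiHypergraph

/-! ### Recognising multiples of graphs, and isomorphisms of induced subhypergraphs -/

section Isomorphisms

variable {H : MultiHypergraph.{u}}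

/-- As every edge has two vertices, it maps to an edge of `Γ`; each fibre of this map has `t`
elements, and numbering the fibres gives the bijection of edges. -/
theorem isomorphic_multiply {n t : ℕ} (Γ : SimpleGraph (Fin n)) (σ : H.V ≃ Fin n)
    (hg : ∀ w, H.GraphAt w) (hΓ : ∀ x y, H.Adj x y → Γ.Adj (σ x) (σ y))
    (ht : ∀ x y, Γ.Adj (σ x) (σ y) → H.mult x y = t) :
    H.Isomorphic (multiply t (ofSimpleGraph Γ)) := by
  classical
  have hpair : ∀ e x y, x ∈ H.inc e → y ∈ H.inc e → x ≠ y → H.inc e = {x, y} := by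
    intro e x y hx hy hxy
    ext z
    constructor
    · intro hz
      by_cases hzx : z = x
      · exact Or.inl hzx
      · exact Or.inr (hg x e hx z hz y hy hzx hxy.symm)
    · rintro (rfl | rfl)
      · exact hx
      · exact hy
  have hs : ∀ e, ∃ s : Γ.edgeSet, σ '' H.inc e = {x | x ∈ s.1} := by
    intro e
    obtain ⟨x, hx, -⟩ : ∃ x ∈ H.inc e, True := by
      have := H.two_le_ncard e
      obtain ⟨x, hx⟩ := Set.nonempty_of_ncard_ne_zero (s := H.inc e) (by omega)
      exact ⟨x, hx, trivial⟩
    obtain ⟨y, hy, hyx⟩ := exists_mem_ne e x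
    refine ⟨⟨s(σ x, σ y), hΓ x y (adj_of_mem hx hy hyx.symm)⟩, ?_⟩
    rw [hpair e x y hx hy hyx.symm, Set.image_pair]
    ext z; simp
  choose g hgs using hs
  have hcard : ∀ s : Γ.edgeSet, Nat.card {e // g e = s} = t := by
    rintro ⟨s, hs⟩
    induction s using Sym2.ind with
    | _ i j =>
      obtain ⟨x, rfl⟩ := σ.surjective i
      obtain ⟨y, rfl⟩ := σ.surjective j
      rw [← ht x y hs, mult]
      have hxy : x ≠ y := fun h => (Γ.ne_of_adj hs) (congrArg σ h)
      change Nat.card ({e | g e = ⟨s(σ x, σ y), hs⟩} : Set H.E) = _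
      rw [Nat.card_coe_set_eq]
      congr 1
      ext e
      constructor
      · intro he
        have h := hgs e
        rw [show g e = _ from he] at h
        have hmem : ∀ z, σ z ∈ σ '' H.inc e → z ∈ H.inc e := fun z hz => by
          rwa [σ.injective.mem_set_image] at hz
        exact ⟨hmem x (by rw [h]; simp), hmem y (by rw [h]; simp)⟩
      · rintro ⟨hx, hy⟩
        have h := hgs e
        rw [hpair e x y hx hy hxy, Set.image_pair] at h
        refine Subtype.ext ?_
        have hx' : σ x ∈ (g e).1 := h.le (by simp)
        have hy' : σ y ∈ (g e).1 := h.le (by simp)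
        exact ((Sym2.mem_and_mem_iff (fun h => hxy (σ.injective h))).1 ⟨hx', hy'⟩)
  let ε : H.E ≃ Γ.edgeSet × Fin t :=
    (Equiv.sigmaFiberEquiv g).symm.trans
      ((Equiv.sigmaCongrRight fun s => Finite.equivFinOfCardEq (hcard s)).trans
        (Equiv.sigmaEquivProd _ _))
  exact ⟨σ, ε, fun e => hgs e⟩

theorem IsCycle.isomorphic {q : H.V} {p : ℕ → H.V} {m t : ℕ} (hp : H.IsCycle q p m)
    (hg : ∀ w, H.GraphAt w) (hn : ∀ w, ∃ s t, H.IsNbrPair w s t)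
    (hsurj : ∀ w, ∃ i ≤ m, p i = w) (ht : ∀ x y, H.Adj x y → H.mult x y = t) :
    H.Isomorphic (multiply t (C (m + 1))) := by
  obtain ⟨k, rfl⟩ : ∃ k, m = k + 2 := ⟨m - 2, by have := hp.two_le; omega⟩
  let τ : Fin (k + 1 + 2) → H.V := fun i => p i
  have hτ : Function.Bijective τ := by
    refine ⟨fun i j hij => Fin.ext (hp.inj _ (by omega) _ (by omega) hij), fun w => ?_⟩
    obtain ⟨i, hi, rfl⟩ := hsurj w
    exact ⟨⟨i, by omega⟩, rfl⟩
  have hnext : ∀ i, H.Adj (τ i) (τ (i + 1)) := by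
    intro i
    by_cases hi : i = Fin.last _
    · subst hi
      rw [Fin.last_add_one]
      change H.Adj (p (k + 2)) (p 0)
      rw [hp.zero]
      exact hp.last
    · have hlt := Fin.val_lt_last hi
      have := hp.adj i.1 (by omega)
      rwa [← Fin.val_add_one_of_lt (Fin.lt_last_iff_ne_last.2 hi)] at this
  have hprev : ∀ i, H.Adj (τ i) (τ (i - 1)) := fun i => by
    have := (hnext (i - 1)).symm
    rwa [sub_add_cancel] at this
  have hiff : ∀ i j, H.Adj (τ i) (τ j) ↔ (SimpleGraph.cycleGraph (k + 1 + 2)).Adj i j := by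
    intro i j
    rw [SimpleGraph.cycleGraph_adj]
    constructor
    · intro hij
      obtain ⟨s, r, hw⟩ := hn (τ i)
      -- Otherwise `2 = 0` modulo the length, which is at least `3`.
      have hne : τ (i - 1) ≠ τ (i + 1) := by
        intro h
        have h1 := hτ.1 h
        have h2 : (1 : Fin (k + 1 + 2)) + 1 = 0 := by
          have h3 : i + 1 - (i - 1) = 0 := by rw [← h1, sub_self]
          rw [← h3]; abel
        have := congrArg Fin.val h2
        rw [Fin.val_add] at this
        have h4 : 2 % (k + 1 + 2) = 0 := by simpa using this
        rw [Nat.mod_eq_of_lt (by omega)] at h4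
        omega
      rcases ((hw.of_adj (hprev i) (hnext i) hne).adj_iff _).1 hij with h | h
      · left; rw [hτ.1 h]; abel
      · right; rw [hτ.1 h]; abel
    · rintro (h | h)
      · have : j = i - 1 := by rw [← h]; abel
        rw [this]; exact hprev i
      · have : j = i + 1 := by rw [← h]; abel
        rw [this]; exact hnext i
  let σ := (Equiv.ofBijective τ hτ).symm
  have hσ : ∀ x, τ (σ x) = x := fun x => (Equiv.ofBijective τ hτ).apply_symm_apply x
  refine isomorphic_multiply _ σ hg (fun x y hxy => ?_) fun x y hxy => ?_
  · rw [← hiff, hσ, hσ]; exact hxy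
  · rw [← hiff, hσ, hσ] at hxy; exact ht x y hxy

theorem Isomorphic.symm {H : MultiHypergraph.{u}} {H' : MultiHypergraph.{v}}
    (h : H.Isomorphic H') : H'.Isomorphic H := by
  obtain ⟨f, g, h⟩ := h
  refine ⟨f.symm, g.symm, fun e => ?_⟩
  have := h (g.symm e)
  rw [g.apply_symm_apply] at this
  rw [← this, ← Set.image_comp]
  simp

theorem induce_induce_isomorphic (X : Set H.V) (Y : Set (H.induce X).V) :
    ((H.induce X).induce Y).Isomorphic (H.induce ((Subtype.val : X → H.V) '' Y)) := by
  have hsub : ∀ e, H.inc e ⊆ (Subtype.val : X → H.V) '' Y → H.inc e ⊆ X := fun e he =>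
    he.trans (by rintro _ ⟨y, -, rfl⟩; exact y.2)
  refine ⟨⟨fun y => ⟨y.1.1, y.1, y.2, rfl⟩, fun y => ⟨⟨y.1, ?_⟩, ?_⟩, fun y => rfl, fun y => rfl⟩,
    ⟨fun e => ⟨e.1.1, ?_⟩, fun e => ⟨⟨e.1, hsub e.1 e.2⟩, ?_⟩, fun e => rfl, fun e => rfl⟩, ?_⟩
  · obtain ⟨-, z, -, rfl⟩ := y
    exact z.2
  · obtain ⟨-, z, hz, rfl⟩ := y
    exact hz
  · exact fun z hz => ⟨⟨z, e.1.2 hz⟩, e.2 hz, rfl⟩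
  · intro z hz
    obtain ⟨z', hz', h⟩ := e.2 hz
    rwa [← Subtype.ext h]
  · intro e
    ext z
    constructor
    · rintro ⟨y, hy, rfl⟩
      exact hy
    · intro hz
      obtain ⟨y, hy, h⟩ := z.2
      exact ⟨⟨y, hy⟩, show y.1 ∈ H.inc e.1.1 by rw [h]; exact hz, Subtype.ext h⟩

theorem induce_univ_isomorphic : (H.induce Set.univ).Isomorphic H := by
  refine ⟨Equiv.Set.univ _, ⟨fun e => e.1, fun e => ⟨e, Set.subset_univ _⟩, fun _ => rfl,
    fun _ => rfl⟩, fun e => ?_⟩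
  ext z
  constructor
  · rintro ⟨y, hy, rfl⟩
    exact hy
  · intro hz
    exact ⟨⟨z, trivial⟩, hz, rfl⟩

theorem isEmpty_edge_of_subsingleton (h : Subsingleton H.V) : IsEmpty H.E := by
  refine ⟨fun e => ?_⟩
  have h1 := H.two_le_ncard e
  have h2 := Set.ncard_le_one_of_subsingleton (H.inc e)
  omega

theorem isomorphic_of_subsingleton {H' : MultiHypergraph.{v}} [Subsingleton H.V] (f : H.V ≃ H'.V) :
    H.Isomorphic H' := by
  have h1 := isEmpty_edge_of_subsingleton (H := H) inferInstance
  have h2 := isEmpty_edge_of_subsingleton (H := H') f.symm.subsingleton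
  exact ⟨f, Equiv.equivOfIsEmpty _ _, fun e => h1.elim e⟩

end Isomorphisms

/-! ### Hypergraph properties and the passage to capacities -/

section Properties

variable {P : Set MultiHypergraph.{u}} {H : MultiHypergraph.{u}}

theorem exists_minimalForbidden (hP : IsProperty P) {A : Set H.V} (hA : H.induce A ∉ P) :
    ∃ X ⊆ A, H.induce X ∈ minimalForbidden P ∧ ∀ Y ⊂ X, H.induce Y ∈ P := by
  obtain ⟨X, ⟨hXA, hX⟩, hmin⟩ := Set.exists_min_image {X : Set H.V | X ⊆ A ∧ H.induce X ∉ P}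
    Set.ncard (Set.toFinite _) ⟨A, subset_rfl, hA⟩
  have hY : ∀ Y ⊂ X, H.induce Y ∈ P := by
    intro Y hY
    by_contra h
    exact absurd (hmin Y ⟨hY.1.trans hXA, h⟩) (not_le.2 (Set.ncard_lt_ncard hY (Set.toFinite _)))
  refine ⟨X, hXA, ⟨hX, fun x => ?_⟩, hY⟩
  refine hP _ _ (induce_induce_isomorphic X {x}ᶜ).symm (hY _ ⟨?_, fun h => ?_⟩)
  · rintro _ ⟨y, -, rfl⟩
    exact y.2
  · obtain ⟨y, hy, h'⟩ := h x.2
    exact hy (Subtype.ext h')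

theorem dConst_le_degree (hH : H ∈ minimalForbidden P) (x : H.V) : dConst P ≤ H.degree x :=
  le_trans (Nat.sInf_le (Set.mem_image_of_mem minDegree hH)) (ciInf_le (OrderBot.bddBelow _) x)

theorem minimalForbidden_nonempty (hP : IsProperty P) (hnt : IsNontrivial P) :
    (minimalForbidden P).Nonempty := by
  obtain ⟨-, H, hH⟩ := hnt
  obtain ⟨X, -, hX, -⟩ := exists_minimalForbidden (H := H) hP (A := Set.univ)
    fun h => hH (hP _ _ induce_univ_isomorphic h)
  exact ⟨_, hX⟩

variable (hP : IsProperty P) (hnt : IsNontrivial P) (hher : IsHereditary P)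
include hP hnt hher

theorem nonempty_of_notMem (hH : H ∉ P) : Nonempty H.V := by
  by_contra h
  rw [not_nonempty_iff] at h
  obtain ⟨⟨H₀, hH₀, -⟩, -⟩ := hnt
  refine hH (hP _ _ ?_ (hher H₀ hH₀ ∅))
  have : IsEmpty (H₀.induce ∅).V := inferInstanceAs (IsEmpty (∅ : Set H₀.V))
  exact isomorphic_of_subsingleton (Equiv.equivOfIsEmpty _ _)

theorem induce_singleton_mem (x : H.V) : H.induce {x} ∈ P := by
  obtain ⟨⟨H₀, hH₀, ⟨y⟩⟩, -⟩ := hnt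
  refine hP _ _ ?_ (hher H₀ hH₀ {y})
  have h1 : Unique (H₀.induce {y}).V := inferInstanceAs (Unique ({y} : Set H₀.V))
  have h2 : Unique (H.induce {x}).V := inferInstanceAs (Unique ({x} : Set H.V))
  exact isomorphic_of_subsingleton (Equiv.ofUnique _ _)

/-- An isolated vertex `x` would make `H` the disjoint union of a single vertex and `H - x`, both in
`P`. This is where additivity enters, and it makes `d(P)` positive. -/
theorem degree_pos_of_mem_minimalForbidden (hadd : IsAdditive P) (hH : H ∈ minimalForbidden P)
    (x : H.V) : 0 < H.degree x := by
  classical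
  by_contra h0
  have hx : ∀ e, x ∉ H.inc e := by
    intro e he
    exact h0 ((Set.ncard_pos (Set.toFinite _)).2 ⟨e, he⟩)
  refine hH.1 (hP _ _ ?_ (hadd _ (induce_singleton_mem hP hnt hher x) _ (hH.2 x)))
  have hE : IsEmpty (H.induce {x}).E := by
    have : Subsingleton (H.induce {x}).V := inferInstanceAs (Subsingleton ({x} : Set H.V))
    exact isEmpty_edge_of_subsingleton this
  have hsub : ∀ e, H.inc e ⊆ {x}ᶜ := fun e y hy hyx => hx e (hyx ▸ hy)
  refine ⟨Equiv.Set.sumCompl {x}, (Equiv.emptySum _ _).trans ⟨fun e => e.1, fun e => ⟨e, hsub e⟩,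
    fun _ => rfl, fun _ => rfl⟩, ?_⟩
  rintro (e | e)
  · exact hE.elim e
  · ext z
    constructor
    · rintro ⟨_, ⟨y, hy, rfl⟩, rfl⟩
      exact hy
    · intro hz
      exact ⟨Sum.inr ⟨z, e.2 hz⟩, ⟨⟨z, e.2 hz⟩, hz, rfl⟩, rfl⟩

theorem dConst_pos (hadd : IsAdditive P) : 0 < dConst P := by
  obtain ⟨F, hF, hd⟩ := Nat.sInf_mem ((minimalForbidden_nonempty hP hnt).image minDegree)
  rw [dConst, ← hd]
  have := nonempty_of_notMem hP hnt hher hF.1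
  obtain ⟨x, hx⟩ := exists_eq_ciInf_of_finite (f := F.degree)
  rw [minDegree, ← hx]
  exact degree_pos_of_mem_minimalForbidden hP hnt hher hadd hF x

/-- If `H` has no `(P, L)`-colouring, then giving each colour of a list the capacity `d(P)` yields
a bad hypergraph. -/
theorem exists_isBad {r m : ℕ} (hr : dConst P = r) (hdeg : ∀ x, H.degree x ≤ m * r) {S : Type u}
    {L : H.V → Set S} (hL : ∀ x, (m : ℕ∞) ≤ (L x).encard) (hn : ¬ ListColorable P H L) :
    ∃ (κ : Type u) (_ : Fintype κ) (f : H.V → κ → ℕ), H.IsBad f ∧ (∀ x c, f x c = 0 ∨ f x c = r) ∧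
      (∀ x, ∑ c, f x c = m * r) ∧ ∀ x, ∃ T : Finset κ, T.card = m ∧ ∀ c ∈ T, f x c = r := by
  classical
  have hT : ∀ x, ∃ T : Finset S, (T : Set S) ⊆ L x ∧ T.card = m := by
    intro x
    obtain ⟨t, ht, hc⟩ := Set.exists_subset_encard_eq (hL x)
    have hfin : t.Finite := Set.finite_of_encard_eq_coe hc
    refine ⟨hfin.toFinset, by simpa, ?_⟩
    rw [hfin.encard_eq_coe_toFinset_card] at hc
    exact_mod_cast hc
  choose T hTL hTm using hT
  have := Fintype.ofFinite H.V
  -- Only the colours of the trimmed lists are kept, so that the colour set is finite.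
  let U : Finset S := Finset.univ.biUnion T
  have hTU : ∀ x, T x ⊆ U := fun x => Finset.subset_biUnion_of_mem T (Finset.mem_univ x)
  have hcard : ∀ x, (Finset.univ.filter fun c : U => c.1 ∈ T x).card = m := by
    intro x
    rw [← hTm x, ← Finset.card_map (Function.Embedding.subtype _)]
    congr 1
    ext c
    simp only [Finset.mem_map, Finset.mem_filter, Finset.mem_univ, true_and]
    constructor
    · rintro ⟨c, hc, rfl⟩; exact hc
    · exact fun hc => ⟨⟨c, hTU x hc⟩, hc, rfl⟩
  refine ⟨U, inferInstance, fun x c => if c.1 ∈ T x then r else 0, ⟨fun x => ?_, ?_⟩, fun x c => ?_,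
    fun x => ?_, fun x => ⟨_, hcard x, fun c hc => if_pos (Finset.mem_filter.1 hc).2⟩⟩
  · rw [← Finset.sum_filter, Finset.sum_const, hcard, smul_eq_mul]
    exact hdeg x
  · rintro ⟨φ, hφ⟩
    refine hn ⟨fun x => (φ x).1, fun x => hTL x ?_, fun c => ?_⟩
    · have := hφ.pos (Set.mem_univ x)
      by_contra hc
      exact lt_irrefl _ (this.trans_eq (if_neg hc))
    · by_contra hc
      -- A class outside `P` contains a member of `F(P)`, with all degrees at least `r`; degeneracy
      -- gives it a vertex of smaller degree.
      obtain ⟨X, hX, hXF, -⟩ := exists_minimalForbidden hP hc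
      obtain ⟨⟨x, hx⟩⟩ := nonempty_of_notMem hP hnt hher hXF.1
      obtain ⟨y, hy, hlt⟩ := hφ X (Set.subset_univ _) ⟨x, hx⟩ (φ x) fun y hy =>
        Subtype.ext ((hX hy).trans (hX hx).symm)
      have h1 := dConst_le_degree hXF ⟨y, hy⟩
      have h2 := degree_induce X ⟨y, hy⟩
      rw [hr, h2] at h1
      change H.degIn X y < if (φ x).1 ∈ T y then r else 0 at hlt
      change r ≤ H.degIn X y at h1
      split_ifs at hlt <;> omega
  · by_cases h : c.1 ∈ T x <;> simp [h]
  · rw [← Finset.sum_filter, Finset.sum_const, hcard, smul_eq_mul]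

end Properties

end MultiHypergraph

/-! ### The bound and its equality cases -/

namespace MultiHypergraph

variable {P : Set MultiHypergraph.{u}} {H : MultiHypergraph.{u}}

theorem degree_le_maxDegree (x : H.V) : H.degree x ≤ H.maxDegree :=
  le_ciSup (f := H.degree) (Set.finite_range _).bddAbove x

theorem listChromaticNumber_le {k : ℕ} (h : Choosable P H k) :
    listChromaticNumber P H ≤ k := iInf₂_le k h

theorem not_choosable_of_lt {k : ℕ} (h : (k : ℕ∞) < listChromaticNumber P H) :
    ¬ Choosable P H k := fun h' => absurd (listChromaticNumber_le h') (not_le.2 h)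

variable (hP : IsProperty P) (hnt : IsNontrivial P) (hher : IsHereditary P) {r : ℕ}
  (hr : dConst P = r)
include hP hnt hher hr

/-- A bad connected hypergraph has degrees equal to the capacity sum `(k + 1) * r`, which exceeds `k
* r`. -/
theorem choosable_succ (hr0 : 0 < r) (hH : H.IsConnected) {k : ℕ}
    (hdeg : ∀ x, H.degree x ≤ k * r) : Choosable P H (k + 1) := by
  intro S L hL
  by_contra hn
  obtain ⟨κ, _, f, hb, -, hsum, hT⟩ := exists_isBad hP hnt hher hr
    (fun x => (hdeg x).trans (Nat.mul_le_mul_right r k.le_succ)) hL hn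
  obtain ⟨x⟩ := hH.1
  obtain ⟨T, hTc, -⟩ := hT x
  obtain ⟨c, -⟩ := Finset.card_pos.1 (hTc ▸ k.succ_pos)
  have : Nonempty κ := ⟨c⟩
  obtain ⟨φ, hφ⟩ := hb.exists_hole hH.connOn_univ x
  have h1 := hb.degree_eq hφ
  rw [hsum] at h1
  have := hdeg x
  nlinarith

/-- Such an `H` is not in `P`. The vertices of a minimal forbidden induced subhypergraph have degree
at least `r` in it, so no edge leaves it and it is all of `H`. -/
theorem isRegular_and_mem_of_not_choosable_one (hH : H.IsConnected)
    (hdeg : ∀ x, H.degree x ≤ r) (hn : ¬ Choosable P H 1) :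
    H.IsRegular r ∧ H ∈ minimalForbidden P := by
  have hHP : H ∉ P := by
    refine fun h => hn fun S L hL => ?_
    have : ∀ x, ∃ c, c ∈ L x := fun x =>
      Set.encard_pos.1 (lt_of_lt_of_le (by norm_num) (hL x))
    choose φ hφ using this
    exact ⟨φ, hφ, fun c => hher H h _⟩
  obtain ⟨X, -, hX, hmin⟩ := exists_minimalForbidden (H := H) hP (A := Set.univ)
    fun h => hHP (hP _ _ induce_univ_isomorphic h)
  have hXdeg : ∀ x ∈ X, r ≤ H.degIn X x := fun x hx => by
    have h1 := dConst_le_degree hX ⟨x, hx⟩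
    have h2 := degree_induce X ⟨x, hx⟩
    rw [hr, h2] at h1
    exact h1
  obtain ⟨⟨x, hx⟩⟩ := nonempty_of_notMem hP hnt hher hX.1
  have hXu : X = Set.univ := by
    refine Set.eq_univ_of_forall fun t => ?_
    by_contra ht
    obtain ⟨p, hp, q, hq, ⟨-, e, hpe, hqe⟩, -⟩ :=
      comp_boundary hx (hH.connOn_univ x trivial (Set.mem_univ t)) ht
    exact hq (subset_of_degree_le_degIn ((hdeg p).trans (hXdeg p hp)) hpe hqe)
  subst hXu
  refine ⟨⟨hH.1, fun y => (hdeg y).antisymm ?_⟩, hHP, fun y => hmin _ ⟨Set.subset_univ _, ?_⟩⟩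
  · rw [← degIn_univ]; exact hXdeg y trivial
  · exact fun h => h (Set.mem_univ y) rfl

theorem isomorphic_of_not_choosable (hr0 : 0 < r) (hH : H.IsConnected) {k : ℕ} (hk : 2 ≤ k)
    (hdeg : ∀ x, H.degree x ≤ k * r) (hn : ¬ Choosable P H k) :
    (∃ t n : ℕ, 1 ≤ t ∧ n * t = k * r + t ∧ H.Isomorphic (multiply t (K n))) ∨
    (∃ n : ℕ, 3 ≤ n ∧ Odd n ∧ H.Isomorphic (multiply r (C n)) ∧ k = 2) := by
  unfold Choosable at hn
  push Not at hn
  obtain ⟨S, L, hL, hn⟩ := hn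
  obtain ⟨κ, _, f, hb, hf, hsum, hT⟩ := exists_isBad hP hnt hher hr hdeg hL hn
  have h2c : ∀ x, ∃ a b, a ≠ b ∧ 0 < f x a ∧ 0 < f x b := by
    intro x
    obtain ⟨T, hTc, hTf⟩ := hT x
    obtain ⟨a, ha, b, hb, hab⟩ := Finset.one_lt_card.1 (show 1 < T.card by omega)
    exact ⟨a, b, hab, by rw [hTf a ha]; exact hr0, by rw [hTf b hb]; exact hr0⟩
  obtain ⟨x⟩ := hH.1
  obtain ⟨a, b, hab, ha, hb'⟩ := h2c x
  have : Nonempty κ := ⟨a⟩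
  have h1 := hH.connOn_univ
  have h2 := hb.connOn_compl_singleton h1 hsum h2c
  have hdeq : ∀ x, H.degree x = k * r := fun x => by
    obtain ⟨φ, hφ⟩ := hb.exists_hole h1 x
    rw [hb.degree_eq hφ, hsum]
  obtain ⟨hg, ⟨hadj, t, ht1, ht⟩ | ⟨hnb, q, p, m, t, c, hp, hm, hsurj, ht, hc⟩⟩ :=
    hb.complete_or_cycle h1 h2 hab (fun _ => hb.pos_iff_pos h1 h2 ha)
      (fun _ => hb.pos_iff_pos h1 h2 hb')
  · left
    have hV : 0 < Nat.card H.V := Nat.card_pos_iff.2 ⟨hH.1, inferInstance⟩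
    refine ⟨t, Nat.card H.V, ht1, ?_, isomorphic_multiply _ (Finite.equivFin H.V) hg ?_ ?_⟩
    · rw [← hdeq x, degree_eq_of_mult_eq (hg x) (ht x), ← Nat.succ_mul]
      congr 1; omega
    · exact fun x y hxy => fun h => hxy.1 ((Finite.equivFin H.V).injective h)
    · exact fun x y hxy => ht x y fun h => hxy (congrArg _ h)
  · right
    obtain ⟨s, s', hq⟩ := hnb q
    have htpos : 0 < t := ht q s hq.left ▸ mult_pos hq.left
    -- A capacity equal to the positive multiplicity `t` must be `r`; the degree `2 * t = k * r`
    -- then gives `k = 2`.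
    have htr : t = r := by
      rcases hf q c with h | h <;> omega
    subst htr
    have hd := hdeq q
    rw [degree_eq_of_isNbrPair (hg q) hq, ht q s hq.left, ht q s' hq.right, ← two_mul] at hd
    refine ⟨m + 1, by have := hp.two_le; omega, ?_, hp.isomorphic hg hnb hsurj ht,
      (Nat.eq_of_mul_eq_mul_right htpos hd).symm⟩
    rw [Nat.odd_iff]; omega

end MultiHypergraph

theorem theorem1p5 (P : Set MultiHypergraph.{u}) (hP : MultiHypergraph.IsProperty P)
    (hnt : MultiHypergraph.IsNontrivial P) (hher : MultiHypergraph.IsHereditary P)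
    (hadd : MultiHypergraph.IsAdditive P) (r : ℕ) (hr : MultiHypergraph.dConst P = r)
    (H : MultiHypergraph.{u}) (hH : H.IsConnected) :
    MultiHypergraph.listChromaticNumber P H ≤ ((⌈(H.maxDegree : ℚ) / (r : ℚ)⌉₊ + 1 : ℕ) : ℕ∞) ∧
    (MultiHypergraph.listChromaticNumber P H = ((⌈(H.maxDegree : ℚ) / (r : ℚ)⌉₊ + 1 : ℕ) : ℕ∞) →
      (∃ t k n : ℕ, 1 ≤ t ∧ n * t = k * r + t ∧
        H.Isomorphic (MultiHypergraph.multiply t (MultiHypergraph.K n))) ∨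
      (∃ n : ℕ, 3 ≤ n ∧ Odd n ∧ H.Isomorphic (MultiHypergraph.multiply r (MultiHypergraph.C n)) ∧
        MultiHypergraph.listChromaticNumber P H = 3) ∨
      (H.IsRegular r ∧ H ∈ MultiHypergraph.minimalForbidden P)) := by
  -- Positivity makes the quotient by `r` a genuine one; division by `0` would give `0`.
  have hr0 : 0 < r := hr ▸ MultiHypergraph.dConst_pos hP hnt hher hadd
  generalize hk : ⌈(H.maxDegree : ℚ) / (r : ℚ)⌉₊ = k
  have hdeg : ∀ x, H.degree x ≤ k * r := by
    intro x
    refine (MultiHypergraph.degree_le_maxDegree x).trans ?_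
    have h1 : (H.maxDegree : ℚ) / r ≤ k := hk ▸ Nat.le_ceil _
    rw [div_le_iff₀ (by exact_mod_cast hr0)] at h1
    exact_mod_cast h1
  refine ⟨MultiHypergraph.listChromaticNumber_le
    (MultiHypergraph.choosable_succ hP hnt hher hr hr0 hH hdeg), fun heq => ?_⟩
  have hn : ¬ MultiHypergraph.Choosable P H k := MultiHypergraph.not_choosable_of_lt (by
    rw [heq]; exact_mod_cast k.lt_succ_self)
  -- For `k = 0` there are no edges and `H` is `K_1`; `k = 1` leads to `F(P)`; for `k ≥ 2` there are
  -- two usable colours and the classification applies.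
  obtain rfl | rfl | hk2 : k = 0 ∨ k = 1 ∨ 2 ≤ k := by omega
  · left
    have hsub : Subsingleton H.V := by
      refine ⟨fun x y => ?_⟩
      by_contra hxy
      obtain ⟨p, -, q, -, ⟨-, e, he, -⟩, -⟩ := MultiHypergraph.comp_boundary (K := {x}) rfl
        (hH.connOn_univ x trivial (Set.mem_univ y)) fun h => hxy (Set.mem_singleton_iff.1 h).symm
      have h1 := hdeg p
      have h2 : 0 < H.degree p := (Set.ncard_pos (Set.toFinite _)).2 ⟨e, he⟩
      omega
    obtain ⟨x⟩ := hH.1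
    have : Unique H.V := ⟨⟨x⟩, fun y => Subsingleton.elim y x⟩
    exact ⟨1, 0, 1, le_rfl, by simp,
      MultiHypergraph.isomorphic_of_subsingleton (Equiv.ofUnique H.V (Fin 1))⟩
  · exact Or.inr (Or.inr (MultiHypergraph.isRegular_and_mem_of_not_choosable_one hP hnt hher hr hH
      (by simpa using hdeg) hn))
  · rcases MultiHypergraph.isomorphic_of_not_choosable hP hnt hher hr hr0 hH hk2 hdeg hn with
      ⟨t, n, h1, h2, h3⟩ | ⟨n, h1, h2, h3, rfl⟩
    · exact Or.inl ⟨t, k, n, h1, h2, h3⟩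
    · exact Or.inr (Or.inl ⟨n, h1, h2, h3, by rw [heq]; rfl⟩)
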